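/- Let $d\ge 1$ and $1\le r,q\le\infty$ be such that $\frac{2}{r}+\frac{d}{q}>1$. Then there are a velocity field $b:[0,1)\times\mathbb R^d\to\mathbb R^d$ with $b\in L^r([0,1);L^q(\mathbb R^d))\cap C^\infty([0,1)\times\mathbb R^d)$ whose restriction to $[0,T]\times\mathbb R^d$ has compact support for every $0\le T<1$, an initial datum $u_0\in C_c^\infty(\mathbb R^d)$, and a solution $u\in C^\infty([0,1)\times\mathbb R^d)$ of the Cauchy problem $$\partial_t u+\operatorname{div}(bu)=\Delta u\quad\text{on }[0,1)\times\mathbb R^d,\qquad u(0,\cdot)=u_0,$$ which lies in $L^2_{\rm loc}([0,1);H^1(\mathbb R^d))$, is bounded on $[0,T]\times\mathbb R^d$ for every $T<1$, and satisfies $\sup_{0\le t<1}\|u(t,\cdot)\|_{L^1(\mathbb R^d)}<\infty$, such that $u$ has no uniform in time integrability bound better than in $L^1$, that is: (i) for every measurable $\Phi:[0,\infty)\to[0,\infty)$ with $\Phi(s)/s\to\infty$ as $s\to\infty$ one has $\sup_{0\le t<1}\int_{\mathbb R^d}\Phi(|u(t,x)|)\,dx=\infty$; (ii) equivalently, $u$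 is not uniformly in time equi-integrable: it is not true that for every $\varepsilon>0$ there is $\delta>0$ such that $\int_A|u(t,x)|\,dx\le\varepsilon$ for all $t\in[0,1)$ and all measurable $A\subset\mathbb R^d$ with $|A|\le\delta$; (iii) in particular, for every $1<p\le\infty$, $\lim_{t\to1^-}\|u(t,\cdot)\|_{L^p(\mathbb R^d)}=\infty$. Here $L^r([0,1);L^q(\mathbb R^d))$ is the Bochner space, and $C^\infty$ on $[0,1)\times\mathbb R^d$ includes one-sided smoothness in time at $t=0$. -/

import Mathlib

open MeasureTheory Set Filter Topology
open scoped ENNReal NNReal ContDiff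

namespace AdvectionDiffusion

/-- `d`-dimensional Euclidean space. -/
abbrev E (d : ℕ) : Type := EuclideanSpace ℝ (Fin d)

/-- The divergence `∑ i, ∂ᵢ Vᵢ` of a vector field on Euclidean space. -/
noncomputable def divergence {d : ℕ} (V : E d → E d) (x : E d) : ℝ :=
  ∑ i : Fin d, (fderiv ℝ V x (EuclideanSpace.single i 1)) i

/-- `b ∈ L^r([0,1); L^q(ℝ^d))` in the sense of Bochner: `t ↦ b t` is almost everywhere represented
by a strongly measurable, `r`-integrable map from `[0,1)` to the Banach space `L^q`. -/
def MemLrLq {d : ℕ} (r q : ℝ≥0∞) [Fact (1 ≤ q)] (b : ℝ → E d → E d) : Prop :=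
  ∃ B : ℝ → Lp (E d) q (volume : Measure (E d)),
    MemLp B r (volume.restrict (Ico (0 : ℝ) 1)) ∧
    ∀ᵐ t ∂(volume.restrict (Ico (0 : ℝ) 1)), (B t : E d → E d) =ᵐ[volume] b t

/-- `f` is of class `C^∞` on `[0,1) × ℝ^d` (one-sidedly in time at `t = 0`). The values of `f` at
times outside `[0,1)` are irrelevant. -/
def SmoothOnStrip {d : ℕ} {F : Type*} [NormedAddCommGroup F] [NormedSpace ℝ F]
    (f : ℝ → E d → F) : Prop :=
  ContDiffOn ℝ ∞ (fun z : ℝ × E d => f z.1 z.2) (Ico (0 : ℝ) 1 ×ˢ univ)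

/-- `u` is a smooth solution on `[0,1) × ℝ^d` of `∂ₜ u + div (b u) = Δ u` with `u(0,·) = u₀`.
The time derivative is taken within `[0,1)`, so at `t = 0` it is the right derivative. -/
structure IsSmoothSolution {d : ℕ} (b : ℝ → E d → E d) (u₀ : E d → ℝ) (u : ℝ → E d → ℝ) :
    Prop where
  smooth : SmoothOnStrip u
  initial : u 0 = u₀
  equation : ∀ t ∈ Ico (0 : ℝ) 1, ∀ x : E d,
    derivWithin (fun s => u s x) (Ico (0 : ℝ) 1) t + divergence (fun y => u t y • b t y) x
      = Laplacian.laplacian (u t) x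

/-- `u ∈ L²_loc([0,1); H¹(ℝ^d))`, for functions `u` that are smooth on `[0,1) × ℝ^d` (so that the
weak spatial gradient is the classical one). -/
def MemL2locH1 {d : ℕ} (u : ℝ → E d → ℝ) : Prop :=
  ∀ T : ℝ, 0 ≤ T → T < 1 →
    ∫⁻ t in Icc 0 T, ∫⁻ x : E d, (‖u t x‖ₑ ^ 2 + ‖fderiv ℝ (u t) x‖ₑ ^ 2) < (⊤ : ℝ≥0∞)

/-- `u` is bounded on `[0,T] × ℝ^d` for every `T < 1`. -/
def LocallyBoundedInTime {d : ℕ} (u : ℝ → E d → ℝ) : Prop :=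
  ∀ T : ℝ, 0 ≤ T → T < 1 → ∃ C : ℝ, ∀ t ∈ Icc 0 T, ∀ x : E d, |u t x| ≤ C

/-- For every `T < 1` the fields `b t`, `t ∈ [0,T]`, vanish outside a common compact set. -/
def LocallyCompactSupportInTime {d : ℕ} (b : ℝ → E d → E d) : Prop :=
  ∀ T : ℝ, 0 ≤ T → T < 1 →
    ∃ K : Set (E d), IsCompact K ∧ ∀ t ∈ Icc 0 T, ∀ x ∉ K, b t x = 0

/-- `sup_{0 ≤ t < 1} ‖u(t)‖_{L¹} < ∞`. -/
def UniformlyL1 {d : ℕ} (u : ℝ → E d → ℝ) : Prop :=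
  ∃ C : ℝ≥0, ∀ t ∈ Ico (0 : ℝ) 1, eLpNorm (u t) 1 volume ≤ C

/-- There is no uniform in time integrability bound better than in `L¹`: for every superlinear
`Φ : [0,∞) → [0,∞)` the integrals of `Φ(|u(t)|)` are not bounded uniformly in `t ∈ [0,1)`. -/
def NoBetterThanL1 {d : ℕ} (u : ℝ → E d → ℝ) : Prop :=
  ∀ Φ : ℝ → ℝ, Measurable Φ → (∀ s, 0 ≤ s → 0 ≤ Φ s) →
    Tendsto (fun s => Φ s / s) atTop atTop →
    ⨆ t ∈ Ico (0 : ℝ) 1, ∫⁻ x : E d, ENNReal.ofReal (Φ |u t x|) = (⊤ : ℝ≥0∞)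

/-- The family `(u(t))`, `0 ≤ t < 1`, is uniformly equi-integrable: for every `ε > 0` there is
`δ > 0` with `∫_A |u(t)| ≤ ε` for all `t ∈ [0,1)` and all measurable `A` of measure at most `δ`. -/
def UniformlyEquiIntegrable {d : ℕ} (u : ℝ → E d → ℝ) : Prop :=
  UnifIntegrable (fun t : Ico (0 : ℝ) 1 => u t) 1 (volume : Measure (E d))

end AdvectionDiffusion

/-! The drift is reverse-engineered from the solution. Put `u = e^{tΔ} f + c (g - φ)`, where `g(t,x)
= μ^d φ(μ x)` with `μ = (1-t)^{-1/2}` is a mass-preserving rescaling of a bump `φ` that collapses to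
the origin as `t → 1`. Since `∂ₜ g = div ((μ²/2) g x)`, the field `F = c ∇(g - φ) - (c μ²/2) g x`
has divergence `Δv - ∂ₜ v` for `v = c (g - φ)` (`divergence_flux`), so any `b` with `b u = F` makes
`u` a solution. The datum `f` is so wide that its heat flow is at least `2c` near the support of
`v`. Hence `u ≥ c (1 + g)` there, and `F / u` makes sense.

Moreover `u ≥ c g` everywhere, so the fixed mass `c ∫ φ` stays in a ball of radius `1/μ → 0`. This
alone excludes equi-integrability and superlinear bounds and makes the `L^p` norms blow up
(`Concentrates`).

The delicate point is the size of `b`, because `g` degenerates at the edge of its support. Taking `φ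
= ρ^(n+1)` gives `|F| ≲ μ^(d+1) ρ^n + 1` (`norm_flux_le`), while `u ≳ 1 + μ^d ρ^(n+1)`; by
`pow_mul_pow_le` the quotient is at most of order `μ^(1 + d/(n+1))` on the ball of radius `1/μ`, and
bounded on the rest of the unit ball. Its `L^q` norm is therefore `O((1-t)^(-β))` whenever `β ≥ 0`
and `2β ≥ 1 + d/(n+1) - d/q`. The hypothesis says `1 - d/q < 2/r`, so a large `n` leaves room for `β
r < 1`, or `β = 0` when `r = ∞` (`exists_exponents`).

Smoothness of the heat flow up to `t = 0` comes from writing it as a Gaussian average at scale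
`√(2t)`. -/

namespace AdvectionDiffusion

variable {d : ℕ}

/-! ### Differential operators in coordinates. -/

/-- The `i`-th partial derivative. -/
noncomputable def pderiv (i : Fin d) (f : E d → ℝ) (x : E d) : ℝ :=
  fderiv ℝ f x (EuclideanSpace.single i 1)

/-- The sum of the pure second partial derivatives. -/
noncomputable def pdLaplacian (f : E d → ℝ) (x : E d) : ℝ :=
  ∑ i, pderiv i (pderiv i f) x

/-- Smooth compactly supported functions. -/
def IsTestFun (f : E d → ℝ) : Prop := ContDiff ℝ ∞ f ∧ HasCompactSupport f

theorem eq_sum_single (x : E d) : x = ∑ i, x i • EuclideanSpace.single i (1 : ℝ) := by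
  ext j
  simp [Finset.sum_apply, Pi.single_apply]

theorem fderiv_apply_eq_sum (f : E d → ℝ) (x v : E d) :
    fderiv ℝ f x v = ∑ i, v i * pderiv i f x := by
  conv_lhs => rw [eq_sum_single v]
  simp [pderiv]

theorem contDiff_pderiv {f : E d → ℝ} (hf : ContDiff ℝ ∞ f) (i : Fin d) :
    ContDiff ℝ ∞ (pderiv i f) :=
  (hf.fderiv_right (m := ∞) (by simp)).clm_apply contDiff_const

theorem IsTestFun.pderiv {f : E d → ℝ} (hf : IsTestFun f) (i : Fin d) :
    IsTestFun (pderiv i f) :=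
  ⟨contDiff_pderiv hf.1 i, hf.2.fderiv_apply (𝕜 := ℝ) _⟩

theorem IsTestFun.sum {ι : Type*} (s : Finset ι) {f : ι → E d → ℝ} (hf : ∀ i, IsTestFun (f i)) :
    IsTestFun (fun x => ∑ i ∈ s, f i x) := by
  classical
  induction s using Finset.induction_on with
  | empty =>
    simp only [Finset.sum_empty]
    exact ⟨contDiff_const, HasCompactSupport.zero⟩
  | insert a s ha ih =>
    simp only [Finset.sum_insert ha]
    exact ⟨(hf a).1.add ih.1, (hf a).2.add ih.2⟩

theorem IsTestFun.pdLaplacian {f : E d → ℝ} (hf : IsTestFun f) : IsTestFun (pdLaplacian f) :=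
  IsTestFun.sum _ fun i => (hf.pderiv i).pderiv i

theorem IsTestFun.exists_bound {f : E d → ℝ} (hf : IsTestFun f) : ∃ C, 0 ≤ C ∧ ∀ x, |f x| ≤ C := by
  obtain ⟨C, hC⟩ := hf.2.exists_bound_of_continuous hf.1.continuous
  exact ⟨C, (norm_nonneg _).trans (hC 0), hC⟩

theorem IsTestFun.exists_fderiv_bound {f : E d → ℝ} (hf : IsTestFun f) :
    ∃ C, 0 ≤ C ∧ ∀ x, ‖fderiv ℝ f x‖ ≤ C := by
  obtain ⟨C, hC⟩ := (hf.2.fderiv (𝕜 := ℝ)).exists_bound_of_continuous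
    (hf.1.continuous_fderiv (by simp))
  exact ⟨C, (norm_nonneg _).trans (hC 0), hC⟩

theorem laplacian_eq_pdLaplacian {f : E d → ℝ} (hf : ContDiff ℝ ∞ f) (x : E d) :
    Laplacian.laplacian f x = pdLaplacian f x := by
  rw [InnerProductSpace.laplacian_eq_iteratedFDeriv_orthonormalBasis f
    (EuclideanSpace.basisFun (Fin d) ℝ)]
  refine Finset.sum_congr rfl fun i _ => ?_
  have h : DifferentiableAt ℝ (fderiv ℝ f) x :=
    ((hf.fderiv_right (m := ∞) (by simp)).differentiable (by simp)) x
  simp only [iteratedFDeriv_two_apply, EuclideanSpace.basisFun_apply, pderiv]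
  rw [show AdvectionDiffusion.pderiv i f = fun y => fderiv ℝ f y (EuclideanSpace.single i 1)
    from rfl, fderiv_clm_apply h (differentiableAt_const _)]
  simp

/-- The gradient in coordinates. -/
noncomputable def grad (f : E d → ℝ) (x : E d) : E d := WithLp.toLp 2 fun i => pderiv i f x

theorem contDiff_grad {f : E d → ℝ} (hf : ContDiff ℝ ∞ f) : ContDiff ℝ ∞ (grad f) := by
  rw [contDiff_euclidean]
  exact fun i => contDiff_pderiv hf i

theorem fderiv_coord {V : E d → E d} {x : E d} (hV : DifferentiableAt ℝ V x) (v : E d)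
    (i : Fin d) : (fderiv ℝ V x v) i = fderiv ℝ (fun y => V y i) x v := by
  have := ((EuclideanSpace.proj (𝕜 := ℝ) i).hasFDerivAt.comp x hV.hasFDerivAt).fderiv
  have h2 : (EuclideanSpace.proj (𝕜 := ℝ) i : E d → ℝ) ∘ V = fun y => V y i := rfl
  rw [← h2, this]
  rfl

theorem divergence_grad {f : E d → ℝ} (hf : ContDiff ℝ ∞ f) (x : E d) :
    divergence (grad f) x = Laplacian.laplacian f x := by
  rw [laplacian_eq_pdLaplacian hf]
  refine Finset.sum_congr rfl fun i _ => ?_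
  rw [fderiv_coord ((contDiff_grad hf).differentiable (by simp) x)]
  rfl

theorem divergence_sub {V W : E d → E d} {x : E d} (hV : DifferentiableAt ℝ V x)
    (hW : DifferentiableAt ℝ W x) :
    divergence (fun y => V y - W y) x = divergence V x - divergence W x := by
  simp only [divergence]
  rw [← Finset.sum_sub_distrib, fderiv_fun_sub hV hW]
  simp

theorem divergence_smul_id {g : E d → ℝ} {x : E d} (hg : DifferentiableAt ℝ g x) :
    divergence (fun y => g y • y) x = d * g x + fderiv ℝ g x x := by
  rw [fderiv_apply_eq_sum]
  simp only [divergence]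
  have : ∀ i : Fin d, (fderiv ℝ (fun y => g y • y) x (EuclideanSpace.single i 1)) i
      = g x + x i * pderiv i g x := by
    intro i
    rw [fderiv_fun_smul (f := fun y : E d => y) hg differentiableAt_fun_id, fderiv_fun_id]
    simp [pderiv, mul_comm]
  simp [this, Finset.sum_add_distrib]

/-! ### The Gaussian density and integration by parts. -/

theorem integrable_exp_neg_mul_sq_norm {b : ℝ} (hb : 0 < b) :
    Integrable (fun z : E d => Real.exp (-b * ‖z‖ ^ 2)) := by
  -- A non-integrable function would have integral `0`, but the Gaussian integral formula gives a
  -- positive value.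
  by_contra h
  have h1 := GaussianFourier.integral_rexp_neg_mul_sq_norm (V := E d) hb
  rw [integral_undef h] at h1
  exact absurd h1.symm (by positivity)

/-- The standard Gaussian density. -/
noncomputable def gauss (z : E d) : ℝ :=
  (Real.pi / (1 / 2)) ^ (-(Module.finrank ℝ (E d) / 2 : ℝ)) * Real.exp (-(1 / 2) * ‖z‖ ^ 2)

theorem gauss_pos (z : E d) : 0 < gauss z := by unfold gauss; positivity

theorem integral_gauss : ∫ z : E d, gauss z = 1 := by
  simp only [gauss]
  rw [integral_const_mul, GaussianFourier.integral_rexp_neg_mul_sq_norm (by norm_num),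
    ← Real.rpow_add (by positivity)]
  simp

theorem integrable_gauss : Integrable (gauss : E d → ℝ) :=
  (integrable_exp_neg_mul_sq_norm (by norm_num)).const_mul _

theorem continuous_gauss : Continuous (gauss : E d → ℝ) := by unfold gauss; fun_prop

theorem integrable_norm_mul_gauss : Integrable (fun z : E d => ‖z‖ * gauss z) := by
  refine ((integrable_exp_neg_mul_sq_norm (d := d) (b := 1 / 4) (by norm_num)).const_mul
    ((Real.pi / (1 / 2)) ^ (-(Module.finrank ℝ (E d) / 2 : ℝ)))).mono'
    (continuous_norm.mul continuous_gauss).aestronglyMeasurable (ae_of_all _ fun z => ?_)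
  rw [Real.norm_of_nonneg (mul_nonneg (norm_nonneg _) (gauss_pos z).le)]
  -- Half of the Gaussian decay absorbs the factor `‖z‖`; `‖z‖ ≤ 1 + ‖z‖²/4` is a perfect square.
  have h1 : ‖z‖ ≤ Real.exp (1 / 4 * ‖z‖ ^ 2) := by
    have := Real.add_one_le_exp (1 / 4 * ‖z‖ ^ 2)
    nlinarith [sq_nonneg (‖z‖ - 2)]
  have h2 : Real.exp (-(1 / 4) * ‖z‖ ^ 2)
      = Real.exp (1 / 4 * ‖z‖ ^ 2) * Real.exp (-(1 / 2) * ‖z‖ ^ 2) := by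
    rw [← Real.exp_add]; ring_nf
  rw [h2, gauss, mul_left_comm]
  gcongr

theorem hasFDerivAt_gauss (z : E d) :
    HasFDerivAt (gauss : E d → ℝ) (-(gauss z) • innerSL ℝ z) z := by
  have h := (((hasStrictFDerivAt_norm_sq z).hasFDerivAt.const_mul (-(1 / 2 : ℝ))).exp).const_mul
    ((Real.pi / (1 / 2)) ^ (-(Module.finrank ℝ (E d) / 2 : ℝ)))
  refine h.congr_fderiv ?_
  ext v
  simp [gauss]
  ring

theorem pderiv_gauss (i : Fin d) (z : E d) : pderiv i gauss z = -(z i * gauss z) := by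
  rw [pderiv, (hasFDerivAt_gauss z).fderiv]
  simp [EuclideanSpace.inner_single_right, mul_comm]

theorem abs_coord_le (z : E d) (i : Fin d) : |z i| ≤ ‖z‖ := PiLp.norm_apply_le z i

theorem integrable_mul_gauss {g : E d → ℝ} (hg : Continuous g) {C : ℝ} (hC : ∀ z, |g z| ≤ C) :
    Integrable (fun z => g z * gauss z) :=
  integrable_gauss.bdd_mul hg.aestronglyMeasurable (ae_of_all _ hC)

theorem integrable_mul_coord_gauss {g : E d → ℝ} (hg : Continuous g) {C : ℝ}
    (hC : ∀ z, |g z| ≤ C) (i : Fin d) : Integrable (fun z => g z * (z i * gauss z)) := by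
  refine Integrable.bdd_mul ?_ hg.aestronglyMeasurable (ae_of_all _ hC)
  refine integrable_norm_mul_gauss.mono' ?_ (ae_of_all _ fun z => ?_)
  · exact (((EuclideanSpace.proj (𝕜 := ℝ) i).continuous).mul
      continuous_gauss).aestronglyMeasurable
  · rw [norm_mul, Real.norm_eq_abs, Real.norm_of_nonneg (gauss_pos z).le]
    gcongr
    · exact (gauss_pos z).le
    · exact abs_coord_le z i

/-- Gaussian integration by parts. -/
theorem integral_mul_coord_gauss {g : E d → ℝ} (hg : ContDiff ℝ 1 g) {C C' : ℝ}
    (hC : ∀ z, |g z| ≤ C) (i : Fin d) (hC' : ∀ z, |pderiv i g z| ≤ C') :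
    ∫ z, g z * (z i * gauss z) = ∫ z, pderiv i g z * gauss z := by
  have hc' : Continuous (pderiv i g) := (hg.continuous_fderiv (by simp)).clm_apply continuous_const
  have hw : ∀ z : E d, fderiv ℝ gauss z (EuclideanSpace.single i 1) = -(z i * gauss z) :=
    pderiv_gauss i
  have h := integral_mul_fderiv_eq_neg_fderiv_mul_of_integrable (μ := (volume : Measure (E d)))
    (f := g) (g := gauss) (v := EuclideanSpace.single i 1)
    (integrable_mul_gauss hc' hC')
    (by
      simp only [hw, mul_neg]
      exact (integrable_mul_coord_gauss hg.continuous hC i).neg)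
    (integrable_mul_gauss hg.continuous hC)
    (fun z _ => hg.differentiable (by simp) z)
    (fun z _ => (hasFDerivAt_gauss z).differentiableAt)
  simp only [hw, mul_neg, integral_neg, neg_inj] at h
  exact h

/-! ### The heat flow and its smoothness up to time zero. -/

/-- The Gaussian average of `f` around `p.2` at length scale `p.1`. -/
noncomputable def avg (f : E d → ℝ) (p : ℝ × E d) : ℝ :=
  ∫ z, f (p.2 + p.1 • z) * gauss z

theorem avg_pdLaplacian {f : E d → ℝ} (hf : IsTestFun f) (p : ℝ × E d) :
    avg (pdLaplacian f) p = ∑ i, avg (pderiv i (pderiv i f)) p := by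
  simp only [avg]
  rw [← integral_finsetSum]
  · simp only [pdLaplacian, Finset.sum_mul]
  · intro i _
    obtain ⟨K, -, hK⟩ := ((hf.pderiv i).pderiv i).exists_bound
    exact integrable_mul_gauss (by have := ((hf.pderiv i).pderiv i).1.continuous; fun_prop)
      (fun z => hK _)

/-- Differentiating in the scale `s` brings out the weights `zᵢ`, and Gaussian integration by parts
trades each `zᵢ` for `s` times a further derivative. The explicit factor `s` will cancel the
singular derivative of `√(2t)`. -/
theorem hasFDerivAt_avg {f : E d → ℝ} (hf : IsTestFun f) (p : ℝ × E d) :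
    HasFDerivAt (avg f)
      ((p.1 * avg (pdLaplacian f) p) • ContinuousLinearMap.fst ℝ ℝ (E d)
        + ∑ i, avg (pderiv i f) p •
          (EuclideanSpace.proj (𝕜 := ℝ) i).comp (ContinuousLinearMap.snd ℝ ℝ (E d))) p := by
  obtain ⟨C, hC0, hC⟩ := hf.exists_fderiv_bound
  obtain ⟨C₀, -, hC₀⟩ := hf.exists_bound
  have hfc := hf.1.continuous
  have hdfc := hf.1.continuous_fderiv (by simp)
  have hgc := continuous_gauss (d := d)
  -- The derivative of `(s, x) ↦ x + s z`; its norm is at most `1 + ‖z‖`, which the Gaussian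
  -- dominates.
  set A : E d → (ℝ × E d →L[ℝ] E d) := fun z =>
    ContinuousLinearMap.snd ℝ ℝ (E d) + (ContinuousLinearMap.fst ℝ ℝ (E d)).smulRight z with hA
  have hAc : Continuous A :=
    continuous_const.add ((ContinuousLinearMap.smulRightL ℝ (ℝ × E d) (E d)
      (ContinuousLinearMap.fst ℝ ℝ (E d))).continuous)
  set F' : ℝ × E d → E d → (ℝ × E d →L[ℝ] ℝ) := fun p z =>
    gauss z • (fderiv ℝ f (p.2 + p.1 • z)).comp (A z) with hF'
  have hF'c : ∀ p, Continuous (F' p) := fun p => by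
    refine hgc.smul (Continuous.clm_comp ?_ hAc)
    fun_prop
  have hAn : ∀ z, ‖A z‖ ≤ 1 + ‖z‖ := fun z => by
    refine (norm_add_le _ _).trans (add_le_add (ContinuousLinearMap.norm_snd_le ..) ?_)
    rw [ContinuousLinearMap.norm_smulRight_apply]
    exact mul_le_of_le_one_left (norm_nonneg _) (ContinuousLinearMap.norm_fst_le ..)
  have hb : ∀ p z, ‖F' p z‖ ≤ C * (gauss z + ‖z‖ * gauss z) := fun p z => by
    rw [hF', norm_smul, Real.norm_of_nonneg (gauss_pos z).le]
    have h1 : ‖(fderiv ℝ f (p.2 + p.1 • z)).comp (A z)‖ ≤ C * (1 + ‖z‖) :=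
      (ContinuousLinearMap.opNorm_comp_le _ _).trans
        (mul_le_mul (hC _) (hAn z) (norm_nonneg _) hC0)
    nlinarith [mul_le_mul_of_nonneg_left h1 (gauss_pos z).le]
  have hbi : Integrable (fun z : E d => C * (gauss z + ‖z‖ * gauss z)) :=
    (integrable_gauss.add integrable_norm_mul_gauss).const_mul C
  have hint : ∀ p : ℝ × E d, Integrable (fun z => f (p.2 + p.1 • z) * gauss z) := fun p =>
    integrable_mul_gauss (by fun_prop) (fun z => hC₀ _)
  have hF'int : Integrable (F' p) :=
    hbi.mono' (hF'c p).aestronglyMeasurable (ae_of_all _ (hb p))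
  have key := hasFDerivAt_integral_of_dominated_of_fderiv_le (μ := (volume : Measure (E d)))
    (F := fun (p : ℝ × E d) z => f (p.2 + p.1 • z) * gauss z) (F' := F') (x₀ := p)
    (s := univ) (bound := fun z => C * (gauss z + ‖z‖ * gauss z)) univ_mem
    (Eventually.of_forall fun p => (hint p).aestronglyMeasurable) (hint p)
    (hF'c p).aestronglyMeasurable
    (ae_of_all _ fun z p _ => hb p z) hbi
    (ae_of_all _ fun z p _ => by
      have h1 : HasFDerivAt (fun q : ℝ × E d => q.2 + q.1 • z) (A z) p :=
        hasFDerivAt_snd.add (hasFDerivAt_fst.smul_const z)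
      have h2 := ((hf.1.differentiable (by simp) (p.2 + p.1 • z)).hasFDerivAt.comp p h1)
      exact (h2.mul_const (gauss z)))
  refine key.congr_fderiv ?_
  refine ContinuousLinearMap.ext fun v => ?_
  rw [ContinuousLinearMap.integral_apply hF'int]
  have hpd : ∀ i, IsTestFun (pderiv i f) := fun i => hf.pderiv i
  have hi1 : ∀ i, Integrable (fun z => pderiv i f (p.2 + p.1 • z) * gauss z) := fun i => by
    obtain ⟨K, -, hK⟩ := (hpd i).exists_bound
    exact integrable_mul_gauss (by have := (hpd i).1.continuous; fun_prop) (fun z => hK _)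
  have hi2 : ∀ i, Integrable (fun z => pderiv i f (p.2 + p.1 • z) * (z i * gauss z)) := fun i => by
    obtain ⟨K, -, hK⟩ := (hpd i).exists_bound
    exact integrable_mul_coord_gauss (by have := (hpd i).1.continuous; fun_prop) (fun z => hK _) i
  have hstein : ∀ i, ∫ z, pderiv i f (p.2 + p.1 • z) * (z i * gauss z)
      = p.1 * ∫ z, pderiv i (pderiv i f) (p.2 + p.1 • z) * gauss z := fun i => by
    obtain ⟨K, -, hK⟩ := (hpd i).exists_bound
    obtain ⟨K', -, hK'⟩ := ((hpd i).pderiv i).exists_bound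
    have hd : ∀ z, pderiv i (fun z => pderiv i f (p.2 + p.1 • z)) z
        = p.1 * pderiv i (pderiv i f) (p.2 + p.1 • z) := fun z => by
      have h1 : HasFDerivAt (fun z : E d => p.2 + p.1 • z) (p.1 • ContinuousLinearMap.id ℝ (E d))
        z := ((hasFDerivAt_id z).const_smul p.1).const_add p.2
      have h2 := ((hpd i).1.differentiable (by simp) (p.2 + p.1 • z)).hasFDerivAt.comp z h1
      rw [pderiv]
      erw [h2.fderiv]
      simp [pderiv]
    rw [integral_mul_coord_gauss (C := K) (C' := |p.1| * K')
      (g := fun z => pderiv i f (p.2 + p.1 • z)) ?_ (fun z => hK _)]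
    · simp only [hd, mul_assoc]
      exact integral_const_mul _ _
    · intro z
      rw [hd, abs_mul]
      gcongr
      exact hK' _
    · exact ((hpd i).1.comp (by fun_prop)).of_le (by exact_mod_cast le_top)
  have hsum : ∀ z, F' p z v = ∑ i, (v.2 i * (pderiv i f (p.2 + p.1 • z) * gauss z)
      + v.1 * (pderiv i f (p.2 + p.1 • z) * (z i * gauss z))) := fun z => by
    simp only [hF', hA, smul_apply, ContinuousLinearMap.comp_apply,
      add_apply, ContinuousLinearMap.smulRight_apply,
      ContinuousLinearMap.coe_fst', ContinuousLinearMap.coe_snd', smul_eq_mul]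
    rw [fderiv_apply_eq_sum, Finset.mul_sum]
    refine Finset.sum_congr rfl fun i _ => ?_
    simp
    ring
  simp only [hsum]
  have hi3 : ∀ i, Integrable (fun z => v.2 i * (pderiv i f (p.2 + p.1 • z) * gauss z)
      + v.1 * (pderiv i f (p.2 + p.1 • z) * (z i * gauss z))) := fun i =>
    ((hi1 i).const_mul _).add ((hi2 i).const_mul _)
  rw [integral_finsetSum _ fun i _ => hi3 i]
  simp only [add_apply, smul_apply,
    sum_apply, ContinuousLinearMap.comp_apply, ContinuousLinearMap.coe_fst',
    ContinuousLinearMap.coe_snd', smul_eq_mul, avg_pdLaplacian hf]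
  rw [Finset.mul_sum, Finset.sum_mul, ← Finset.sum_add_distrib]
  refine Finset.sum_congr rfl fun i _ => ?_
  rw [integral_add ((hi1 i).const_mul _) ((hi2 i).const_mul _), integral_const_mul,
    integral_const_mul, hstein, avg, avg]
  simp
  ring

theorem continuous_avg {f : E d → ℝ} (hf : IsTestFun f) : Continuous (avg f) :=
  continuous_iff_continuousAt.2 fun p => (hasFDerivAt_avg hf p).continuousAt

/-- The solution of the heat equation with initial datum `f`. -/
noncomputable def heat (f : E d → ℝ) (p : ℝ × E d) : ℝ := avg f (√(2 * p.1), p.2)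

theorem continuous_heat {f : E d → ℝ} (hf : IsTestFun f) : Continuous (heat f) :=
  (continuous_avg hf).comp (by fun_prop)

/-- The space-time derivative of the heat flow. -/
noncomputable def heatDeriv (f : E d → ℝ) (p : ℝ × E d) : ℝ × E d →L[ℝ] ℝ :=
  heat (pdLaplacian f) p • ContinuousLinearMap.fst ℝ ℝ (E d)
    + ∑ i, heat (pderiv i f) p •
      (EuclideanSpace.proj (𝕜 := ℝ) i).comp (ContinuousLinearMap.snd ℝ ℝ (E d))

theorem continuous_heatDeriv {f : E d → ℝ} (hf : IsTestFun f) : Continuous (heatDeriv f) := by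
  unfold heatDeriv
  refine ((continuous_heat hf.pdLaplacian).smul continuous_const).add
    (continuous_finsetSum _ fun i _ => (continuous_heat (hf.pderiv i)).smul continuous_const)

/-- For `s = √(2t)` one has `s' = 1/s`, which cancels the `s` in `hasFDerivAt_avg`. What remains
involves only heat flows of derivatives of `f`, hence is continuous at `t = 0`. -/
theorem hasFDerivAt_heat {f : E d → ℝ} (hf : IsTestFun f) {p : ℝ × E d} (hp : 0 < p.1) :
    HasFDerivAt (heat f) (heatDeriv f p) p := by
  have hs : HasFDerivAt (fun p : ℝ × E d => √(2 * p.1))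
      ((1 / √(2 * p.1)) • ContinuousLinearMap.fst ℝ ℝ (E d)) p := by
    have := (((hasFDerivAt_fst (𝕜 := ℝ) (p := p)).const_mul (2 : ℝ)).sqrt (by positivity))
    refine this.congr_fderiv ?_
    ext v <;> simp
  have h := (hasFDerivAt_avg hf (√(2 * p.1), p.2)).comp p (hs.prodMk hasFDerivAt_snd)
  refine h.congr_fderiv ?_
  have : √(2 * p.1) ≠ 0 := by positivity
  ext v <;> simp [heatDeriv, heat]
  field_simp

/-- The interior derivative has a continuous extension to the boundary of a convex open set, so the
extension is the one-sided derivative there. -/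
theorem hasFDerivWithinAt_heat {f : E d → ℝ} (hf : IsTestFun f) {p : ℝ × E d} :
    HasFDerivWithinAt (heat f) (heatDeriv f p) (Ici 0 ×ˢ univ) p := by
  have ho : IsOpen ((Ioi (0 : ℝ)) ×ˢ (univ : Set (E d))) := isOpen_Ioi.prod isOpen_univ
  have hcl : closure ((Ioi (0 : ℝ)) ×ˢ (univ : Set (E d))) = Ici 0 ×ˢ univ := by
    rw [closure_prod_eq, closure_Ioi, closure_univ]
  rw [← hcl]
  refine hasFDerivWithinAt_closure_of_tendsto_fderiv
    (fun q hq => (hasFDerivAt_heat hf hq.1).differentiableAt.differentiableWithinAt)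
    ((convex_Ioi 0).prod convex_univ) ho
    (fun q _ => (continuous_heat hf).continuousWithinAt) ?_
  refine ((continuous_heatDeriv hf).continuousWithinAt (s := Ioi 0 ×ˢ univ) (x := p)).congr' ?_
  filter_upwards [self_mem_nhdsWithin] with q hq
  exact (hasFDerivAt_heat hf hq.1).fderiv.symm

/-- Bootstrap: the derivative is again built from heat flows of test functions, so the induction
runs over all `f` at once. -/
theorem contDiffOn_heat {f : E d → ℝ} (hf : IsTestFun f) :
    ContDiffOn ℝ ∞ (heat f) (Ici 0 ×ˢ univ) := by
  rw [contDiffOn_infty]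
  intro n
  induction n generalizing f with
  | zero => exact contDiffOn_zero.2 (continuous_heat hf).continuousOn
  | succ n ih =>
    have hu : UniqueDiffOn ℝ ((Ici (0 : ℝ)) ×ˢ (univ : Set (E d))) :=
      (uniqueDiffOn_Ici 0).prod uniqueDiffOn_univ
    push_cast
    rw [contDiffOn_succ_iff_hasFDerivWithinAt_of_uniqueDiffOn hu]
    refine ⟨by simp, heatDeriv f, ?_, fun p _ => hasFDerivWithinAt_heat hf⟩
    unfold heatDeriv
    exact ((ih hf.pdLaplacian).smul contDiffOn_const).add
      (ContDiffOn.sum fun i _ => (ih (hf.pderiv i)).smul contDiffOn_const)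

/-! ### Consequences of concentration of mass. -/

/-- `u(t)` carries at least the mass `ε` on the set `A t`, whose measure vanishes as `t → 1`. -/
structure Concentrates (u : ℝ → E d → ℝ) (A : ℝ → Set (E d)) (ε : ℝ) : Prop where
  pos : 0 < ε
  measurable : ∀ t ∈ Ico (0 : ℝ) 1, Measurable (u t)
  measurableSet : ∀ t, MeasurableSet (A t)
  mass : ∀ t ∈ Ico (0 : ℝ) 1, ENNReal.ofReal ε ≤ ∫⁻ x in A t, ‖u t x‖ₑ
  tendsto : Tendsto (fun t => volume (A t)) (𝓝[<] 1) (𝓝 0)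

namespace Concentrates

variable {u : ℝ → E d → ℝ} {A : ℝ → Set (E d)} {ε : ℝ}

theorem Ico_mem : Ico (0 : ℝ) 1 ∈ 𝓝[<] (1 : ℝ) := Ico_mem_nhdsLT zero_lt_one

theorem not_uniformlyEquiIntegrable (h : Concentrates u A ε) : ¬ UniformlyEquiIntegrable u := by
  intro hu
  obtain ⟨δ, hδ, H⟩ := hu (half_pos h.pos)
  have h1 : ∀ᶠ t in 𝓝[<] (1 : ℝ), volume (A t) < ENNReal.ofReal δ :=
    h.tendsto.eventually_lt_const (by simpa using hδ)
  obtain ⟨t, ht, htI⟩ := (h1.and Ico_mem).exists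
  have h2 := H ⟨t, htI⟩ (A t) (h.measurableSet t) ht.le
  rw [eLpNorm_indicator_eq_eLpNorm_restrict (h.measurableSet t), eLpNorm_one_eq_lintegral_enorm]
    at h2
  have h3 := (h.mass t htI).trans h2
  rw [ENNReal.ofReal_le_ofReal_iff (half_pos h.pos).le] at h3
  linarith [h.pos]

/-- Hölder on `A t` gives `ε ≤ ‖u t‖_p |A t|^(1 - 1/p)`, and the last factor tends to `0`. -/
theorem tendsto_eLpNorm (h : Concentrates u A ε) {p : ℝ≥0∞} (hp : 1 < p) :
    Tendsto (fun t => eLpNorm (u t) p volume) (𝓝[<] (1 : ℝ)) (𝓝 (⊤ : ℝ≥0∞)) := by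
  -- For `p = ⊤` the conventions `⊤.toReal = 0` and `1 / 0 = 0` give the correct exponent `1`.
  set a : ℝ := 1 / (1 : ℝ≥0∞).toReal - 1 / p.toReal with ha
  have ha0 : 0 < a := by
    rw [ha]
    rcases eq_or_ne p ⊤ with rfl | hpt
    · simp
    · have : 1 < p.toReal := by
        have := (ENNReal.toReal_lt_toReal ENNReal.one_ne_top hpt).2 hp
        simpa using this
      have h2 : 1 / p.toReal < 1 := by rw [div_lt_one (by linarith)]; exact this
      simpa using h2
  rw [ENNReal.tendsto_nhds_top_iff_nnreal]
  intro K
  have h1 : Tendsto (fun t => (K : ℝ≥0∞) * volume (A t) ^ a) (𝓝[<] 1) (𝓝 0) := by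
    have := ENNReal.Tendsto.const_mul (a := (K : ℝ≥0∞)) (h.tendsto.ennrpow_const a)
      (Or.inr ENNReal.coe_ne_top)
    simpa [ENNReal.zero_rpow_of_pos ha0] using this
  filter_upwards [h1.eventually_lt_const (show 0 < ENNReal.ofReal ε by simpa using h.pos), Ico_mem]
    with t ht htI
  by_contra! hK
  have h2 := eLpNorm_le_eLpNorm_mul_rpow_measure_univ (μ := volume.restrict (A t)) hp.le
    (h.measurable t htI).aestronglyMeasurable
  rw [eLpNorm_one_eq_lintegral_enorm, Measure.restrict_apply_univ, ← ha] at h2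
  refine absurd ((h.mass t htI).trans (h2.trans ?_)) (not_le.2 ht)
  gcongr
  exact (eLpNorm_mono_measure _ Measure.restrict_le_self).trans hK

/-- The de la Vallée-Poussin argument: splitting at a high level `s`, the mass on `A t` is at most
`s |A t| + S / M`, where `S` is the supposedly finite supremum. -/
theorem noBetterThanL1 (h : Concentrates u A ε) : NoBetterThanL1 u := by
  intro Φ hΦ hΦ0 hΦt
  by_contra hS
  set S := ⨆ t ∈ Ico (0 : ℝ) 1, ∫⁻ x : E d, ENNReal.ofReal (Φ |u t x|) with hSdef
  have hε := h.pos
  -- Chosen so that `S / M ≤ ε / 2`; the `+ 1` keeps `M` positive when `S = 0`.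
  set M : ℝ := 2 * (S.toReal + 1) / ε with hM
  have hST : 0 ≤ S.toReal := ENNReal.toReal_nonneg
  have hM0 : 0 < M := by positivity
  obtain ⟨s₀, hs₀⟩ := (hΦt.eventually_ge_atTop M).exists_forall_of_atTop
  set s := max s₀ 1 with hs
  have hs1 : 0 < s := lt_of_lt_of_le one_pos (le_max_right _ _)
  have hpt : ∀ y : ℝ, ‖y‖ₑ ≤ ENNReal.ofReal s + ENNReal.ofReal (1 / M) * ENNReal.ofReal (Φ |y|) := by
    intro y
    rw [← ENNReal.ofReal_mul (by positivity),
      ← ENNReal.ofReal_add hs1.le (mul_nonneg (by positivity) (hΦ0 _ (abs_nonneg _))),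
      ← ofReal_norm, Real.norm_eq_abs]
    apply ENNReal.ofReal_le_ofReal
    rcases le_total |y| s with hy | hy
    · have := mul_nonneg (by positivity : 0 ≤ 1 / M) (hΦ0 _ (abs_nonneg y))
      linarith
    · have h1 := hs₀ |y| ((le_max_left _ _).trans hy)
      rw [le_div_iff₀ (hs1.trans_le hy)] at h1
      have : |y| ≤ 1 / M * Φ |y| := by
        rw [one_div, inv_mul_eq_div, le_div_iff₀ hM0]; linarith
      linarith
  have hlim : Tendsto (fun t => ENNReal.ofReal s * volume (A t)) (𝓝[<] 1) (𝓝 0) := by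
    have := ENNReal.Tendsto.const_mul (a := ENNReal.ofReal s) h.tendsto
      (Or.inr ENNReal.ofReal_ne_top)
    simpa using this
  obtain ⟨t, ht, htI⟩ := ((hlim.eventually_lt_const
    (show 0 < ENNReal.ofReal (ε / 2) by simpa using hε)).and Ico_mem).exists
  have hSt : ∫⁻ x : E d, ENNReal.ofReal (Φ |u t x|) ≤ S :=
    le_iSup₂_of_le (f := fun (t : ℝ) (_ : t ∈ Ico (0 : ℝ) 1) =>
      ∫⁻ x : E d, ENNReal.ofReal (Φ |u t x|)) t htI le_rfl
  have hmass : ENNReal.ofReal ε ≤ ENNReal.ofReal s * volume (A t) + ENNReal.ofReal (1 / M) * S := by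
    refine (h.mass t htI).trans ((lintegral_mono fun x => hpt (u t x)).trans ?_)
    rw [lintegral_add_left measurable_const, lintegral_const, Measure.restrict_apply_univ,
      lintegral_const_mul' _ _ ENNReal.ofReal_ne_top]
    gcongr
    exact (lintegral_mono' Measure.restrict_le_self le_rfl).trans hSt
  have hS2 : ENNReal.ofReal (1 / M) * S ≤ ENNReal.ofReal (ε / 2) := by
    rw [← ENNReal.ofReal_toReal hS, ← ENNReal.ofReal_mul (by positivity)]
    apply ENNReal.ofReal_le_ofReal
    rw [hM, one_div_div, div_mul_eq_mul_div, div_le_iff₀ (by positivity)]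
    nlinarith
  have : ENNReal.ofReal ε < ENNReal.ofReal (ε / 2) + ENNReal.ofReal (ε / 2) :=
    hmass.trans_lt (ENNReal.add_lt_add_of_lt_of_le (ne_top_of_le_ne_top ENNReal.ofReal_ne_top hS2) ht hS2)
  rw [← ENNReal.ofReal_add (by positivity) (by positivity), add_halves] at this
  exact lt_irrefl _ this

end Concentrates

/-! ### Bounds and equation for the heat flow. -/

theorem heat_zero (f : E d → ℝ) (x : E d) : heat f (0, x) = f x := by
  simp [heat, avg, integral_const_mul, integral_gauss]

theorem abs_heat_le {f : E d → ℝ} {C : ℝ} (hC : ∀ x, |f x| ≤ C) (p : ℝ × E d) :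
    |heat f p| ≤ C := by
  have h := norm_integral_le_of_norm_le (μ := (volume : Measure (E d)))
    (f := fun z => f (p.2 + √(2 * p.1) • z) * gauss z)
    (integrable_gauss.const_mul C) (ae_of_all _ fun z => by
      rw [norm_mul, Real.norm_of_nonneg (gauss_pos z).le]
      exact mul_le_mul_of_nonneg_right (hC _) (gauss_pos z).le)
  rwa [integral_const_mul, integral_gauss, mul_one] at h

theorem heat_nonneg {f : E d → ℝ} (hf : ∀ x, 0 ≤ f x) (p : ℝ × E d) : 0 ≤ heat f p :=
  integral_nonneg fun z => mul_nonneg (hf _) (gauss_pos z).le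

/-- Tonelli: for each fixed `z` the integrand is a translate of `f` in `x`, and the Gaussian has
mass one. -/
theorem lintegral_enorm_heat_le {f : E d → ℝ} (hf : Continuous f) (t : ℝ) :
    ∫⁻ x, ‖heat f (t, x)‖ₑ ≤ ∫⁻ x, ‖f x‖ₑ := by
  have hg := continuous_gauss (d := d)
  calc ∫⁻ x, ‖heat f (t, x)‖ₑ
      ≤ ∫⁻ x, ∫⁻ z, ‖f (x + √(2 * t) • z) * gauss z‖ₑ :=
        lintegral_mono fun x => enorm_integral_le_lintegral_enorm _
    _ = ∫⁻ z, ∫⁻ x, ‖f (x + √(2 * t) • z) * gauss z‖ₑ :=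
        lintegral_lintegral_swap (Continuous.aemeasurable (by
          simp only [Function.uncurry_def]; fun_prop))
    _ = ∫⁻ z, (∫⁻ x, ‖f x‖ₑ) * ‖(gauss z : ℝ)‖ₑ := by
        refine lintegral_congr fun z => ?_
        simp only [enorm_mul]
        rw [lintegral_mul_const' _ _ enorm_ne_top,
          lintegral_add_right_eq_self (fun x => ‖f x‖ₑ)]
    _ = ∫⁻ x, ‖f x‖ₑ := by
        rw [lintegral_const_mul _ (by fun_prop)]
        have : ∫⁻ z : E d, ‖(gauss z : ℝ)‖ₑ = 1 := by
          rw [← ofReal_integral_norm_eq_lintegral_enorm integrable_gauss]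
          simp [Real.norm_of_nonneg (gauss_pos _).le, integral_gauss]
        rw [this, mul_one]

theorem lintegral_enorm_lt_top {f : E d → ℝ} (hf : IsTestFun f) : ∫⁻ x, ‖f x‖ₑ < ⊤ :=
  (hf.1.continuous.integrable_of_hasCompactSupport hf.2).2

theorem contDiff_heat {f : E d → ℝ} (hf : IsTestFun f) {t : ℝ} (ht : 0 ≤ t) :
    ContDiff ℝ ∞ (fun x => heat f (t, x)) := by
  rw [← contDiffOn_univ]
  exact (contDiffOn_heat hf).comp (contDiff_const.prodMk contDiff_id).contDiffOn
    (fun x _ => ⟨ht, mem_univ _⟩)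

theorem pderiv_heat {f : E d → ℝ} (hf : IsTestFun f) (t : ℝ) (i : Fin d) (x : E d) :
    pderiv i (fun x => heat f (t, x)) x = heat (pderiv i f) (t, x) := by
  have h := (hasFDerivAt_avg hf (√(2 * t), x)).comp x
    ((hasFDerivAt_const (√(2 * t)) x).prodMk (hasFDerivAt_id x))
  rw [pderiv]
  erw [h.fderiv]
  simp [heat]

theorem laplacian_heat {f : E d → ℝ} (hf : IsTestFun f) {t : ℝ} (ht : 0 ≤ t) (x : E d) :
    Laplacian.laplacian (fun x => heat f (t, x)) x = heat (pdLaplacian f) (t, x) := by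
  rw [laplacian_eq_pdLaplacian (contDiff_heat hf ht), pdLaplacian, heat, avg_pdLaplacian hf]
  refine Finset.sum_congr rfl fun i _ => ?_
  rw [show pderiv i (fun x => heat f (t, x)) = fun x => heat (pderiv i f) (t, x) from
    funext (pderiv_heat hf t i), pderiv_heat (hf.pderiv i)]
  rfl

theorem hasDerivWithinAt_heat {f : E d → ℝ} (hf : IsTestFun f) (t : ℝ) (x : E d) :
    HasDerivWithinAt (fun s => heat f (s, x)) (heat (pdLaplacian f) (t, x)) (Ici 0) t := by
  have h1 : HasDerivAt (fun s : ℝ => (s, x)) ((1 : ℝ), (0 : E d)) t :=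
    (hasDerivAt_id t).prodMk (hasDerivAt_const t x)
  have hm : MapsTo (fun s : ℝ => (s, x)) (Ici 0) (Ici 0 ×ˢ univ) := fun s hs => ⟨hs, mem_univ _⟩
  have h : HasDerivWithinAt (heat f ∘ fun s => (s, x)) _ (Ici 0) t :=
    (hasFDerivWithinAt_heat hf (p := (t, x))).comp_hasDerivWithinAt t h1.hasDerivWithinAt hm
  exact h.congr_deriv (by simp [heatDeriv])

/-- For `t < 1` the scale `√(2t)` is at most `2`, so averaging over `‖z‖ ≤ 1` only sees points where
`f ≥ 1`. The Gaussian mass of the unit ball is thus a valid `m`. -/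
theorem exists_heat_lower_bound {f : E d → ℝ} (hf : IsTestFun f) (hf0 : ∀ x, 0 ≤ f x) {R : ℝ}
    (hf1 : ∀ x, ‖x‖ ≤ R + 2 → 1 ≤ f x) :
    ∃ m, 0 < m ∧ ∀ t ∈ Ico (0 : ℝ) 1, ∀ x : E d, ‖x‖ ≤ R → m ≤ heat f (t, x) := by
  obtain ⟨C, -, hC⟩ := hf.exists_bound
  have hfc := hf.1.continuous
  refine ⟨∫ z in Metric.closedBall (0 : E d) 1, gauss z, ?_, fun t ht x hx => ?_⟩
  · rw [setIntegral_pos_iff_support_of_nonneg_ae (ae_of_all _ fun z => (gauss_pos z).le)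
      integrable_gauss.integrableOn]
    have : Function.support (gauss : E d → ℝ) = univ := by
      ext z; simp [(gauss_pos z).ne']
    rw [this, univ_inter]
    exact Metric.measure_closedBall_pos _ _ one_pos
  · have hi : Integrable (fun z => f (x + √(2 * t) • z) * gauss z) :=
      integrable_mul_gauss (by fun_prop) (fun z => hC _)
    refine le_trans (setIntegral_mono_on integrable_gauss.integrableOn hi.integrableOn
      measurableSet_closedBall fun z hz => ?_) (setIntegral_le_integral hi
        (ae_of_all _ fun z => mul_nonneg (hf0 _) (gauss_pos z).le))
    refine le_mul_of_one_le_left (gauss_pos z).le (hf1 _ ?_)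
    have h2 : √(2 * t) ≤ 2 := by
      rw [Real.sqrt_le_left (by norm_num)]; linarith [ht.2]
    rw [mem_closedBall_zero_iff] at hz
    calc ‖x + √(2 * t) • z‖ ≤ ‖x‖ + ‖√(2 * t) • z‖ := norm_add_le _ _
      _ ≤ R + 2 * 1 := by
        rw [norm_smul, Real.norm_of_nonneg (Real.sqrt_nonneg _)]
        gcongr
      _ = R + 2 := by ring

/-! ### Membership in the Bochner space. -/

theorem memLp_one_sub_rpow {r : ℝ≥0∞} (hr : 1 ≤ r) {C β : ℝ}
    (hβ : r ≠ ⊤ → β * r.toReal < 1) (hβ' : r = ⊤ → β = 0) :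
    MemLp (fun t : ℝ => C * (1 - t) ^ (-β)) r (volume.restrict (Ico (0 : ℝ) 1)) := by
  rcases eq_or_ne r ⊤ with rfl | hrt
  · simp only [hβ' rfl, neg_zero, Real.rpow_zero, mul_one]
    exact memLp_const C
  have hr0 : r ≠ 0 := (one_pos.trans_le hr).ne'
  have hmeas : Measurable (fun t : ℝ => (1 - t) ^ (-β)) := by fun_prop
  refine MemLp.const_mul ?_ C
  rw [← integrable_norm_rpow_iff hmeas.aestronglyMeasurable hr0 hrt]
  have h1 : IntervalIntegrable (fun s : ℝ => s ^ (-(β * r.toReal))) volume 0 1 :=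
    intervalIntegral.intervalIntegrable_rpow' (by linarith [hβ hrt])
  have h2 := (h1.comp_sub_left 1).symm
  simp only [sub_self, sub_zero] at h2
  rw [intervalIntegrable_iff_integrableOn_Ico_of_le zero_le_one] at h2
  refine h2.congr_fun (fun t ht => ?_) measurableSet_Ico
  have : 0 ≤ 1 - t := by linarith [ht.2]
  simp only
  rw [Real.norm_of_nonneg (Real.rpow_nonneg this _), ← Real.rpow_mul this]
  ring_nf

/-- The common bounded support makes `t ↦ b t` continuous into `L^q`, also for `q = ∞`; this gives
strong measurability, and the power of `1 - t` dominates the norm. -/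
theorem memLrLq_of_eLpNorm_le {b : ℝ → E d → E d} {r q : ℝ≥0∞} [Fact (1 ≤ q)] (hr : 1 ≤ r)
    (hb : ContinuousOn (fun z : ℝ × E d => b z.1 z.2) (Ico (0 : ℝ) 1 ×ˢ univ)) {R : ℝ}
    (hsupp : ∀ t ∈ Ico (0 : ℝ) 1, ∀ x, R < ‖x‖ → b t x = 0) {C β : ℝ} (hC : 0 ≤ C)
    (hβ : r ≠ ⊤ → β * r.toReal < 1) (hβ' : r = ⊤ → β = 0)
    (hbound : ∀ t ∈ Ico (0 : ℝ) 1, eLpNorm (b t) q volume ≤ ENNReal.ofReal (C * (1 - t) ^ (-β))) :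
    MemLrLq r q b := by
  classical
  have hbt : ∀ t ∈ Ico (0 : ℝ) 1, Continuous (b t) := fun t ht =>
    continuousOn_univ.1 (hb.comp (by fun_prop : Continuous fun x : E d => (t, x)).continuousOn
      fun x _ => ⟨ht, mem_univ _⟩)
  have hmem : ∀ t ∈ Ico (0 : ℝ) 1, MemLp (b t) q volume := fun t ht =>
    ⟨(hbt t ht).aestronglyMeasurable, (hbound t ht).trans_lt ENNReal.ofReal_lt_top⟩
  let B : ℝ → Lp (E d) q (volume : Measure (E d)) := fun t =>
    if h : t ∈ Ico (0 : ℝ) 1 then (hmem t h).toLp (b t) else 0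
  have hBI : ∀ t (ht : t ∈ Ico (0 : ℝ) 1), B t = (hmem t ht).toLp (b t) := fun t ht => dif_pos ht
  have hBcont : ContinuousOn B (Ico 0 1) := by
    intro t₀ ht₀
    rw [ContinuousWithinAt, tendsto_iff_edist_tendsto_0]
    rw [ENNReal.tendsto_nhds_zero]
    intro ε hε
    set V := volume (Metric.closedBall (0 : E d) R) ^ (1 / q.toReal) with hV
    have hVt : V ≠ ⊤ := ENNReal.rpow_ne_top_of_nonneg (by positivity)
      measure_closedBall_lt_top.ne
    obtain ⟨η, hη0, hη⟩ : ∃ η : ℝ≥0, 0 < η ∧ (η : ℝ≥0∞) * V ≤ ε := by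
      obtain ⟨η, hη0, hη⟩ := ENNReal.exists_nnreal_pos_mul_lt hVt hε.ne'
      exact ⟨η, hη0, hη.le⟩
    -- Joint continuity on a compact ball gives convergence uniform in `x` as `t → t₀`.
    obtain ⟨v, hv, H⟩ := (isCompact_closedBall (0 : E d) R).mem_uniformity_of_prod (f := b)
      (s := Ico (0 : ℝ) 1) (hb.mono (prod_mono_right (subset_univ _))) ht₀
      (Metric.dist_mem_uniformity (show (0 : ℝ) < η from hη0))
    filter_upwards [hv, self_mem_nhdsWithin] with t ht htI
    rw [hBI t htI, hBI t₀ ht₀, Lp.edist_toLp_toLp]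
    refine le_trans (eLpNorm_mono (g := (Metric.closedBall (0 : E d) R).indicator
      fun _ => (η : ℝ)) fun x => ?_)
      ((eLpNorm_indicator_const_le _ _).trans ?_)
    · by_cases hx : x ∈ Metric.closedBall (0 : E d) R
      · rw [indicator_of_mem hx]
        have := H t ht x hx
        simp only [mem_ofPred_eq, dist_eq_norm] at this
        simpa using this.le
      · rw [Metric.mem_closedBall, dist_zero_right, not_le] at hx
        simp [hsupp t htI x hx, hsupp t₀ ht₀ x hx]
    · refine le_trans (le_of_eq ?_) hη
      rw [hV]
      congr 1
      rw [← ofReal_norm]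
      simp
  refine ⟨B, ?_, ?_⟩
  · refine (memLp_one_sub_rpow (C := C) hr hβ hβ').mono
      (hBcont.aestronglyMeasurable measurableSet_Ico) ?_
    filter_upwards [ae_restrict_mem measurableSet_Ico] with t ht
    rw [hBI t ht, Lp.norm_toLp]
    refine le_trans ?_ (le_abs_self _)
    exact ENNReal.toReal_le_of_le_ofReal
      (mul_nonneg hC (Real.rpow_nonneg (by linarith [ht.2]) _)) (hbound t ht)
  · filter_upwards [ae_restrict_mem measurableSet_Ico] with t ht
    rw [hBI t ht]
    exact (hmem t ht).coeFn_toLp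

/-! ### The concentrating profile and its flux. -/

/-- The inverse of the concentration scale `√(1 - t)`. -/
noncomputable def mu (t : ℝ) : ℝ := (1 - t) ^ (-(1 / 2) : ℝ)

theorem mu_zero : mu 0 = 1 := by simp [mu]

theorem mu_pos {t : ℝ} (ht : t < 1) : 0 < mu t := Real.rpow_pos_of_pos (by linarith) _

theorem one_le_mu {t : ℝ} (ht : t ∈ Ico (0 : ℝ) 1) : 1 ≤ mu t :=
  Real.one_le_rpow_of_pos_of_le_one_of_nonpos (by linarith [ht.2]) (by linarith [ht.1])
    (by norm_num)

theorem mu_rpow {t : ℝ} (ht : t < 1) (a : ℝ) : mu t ^ (2 * a) = (1 - t) ^ (-a) := by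
  rw [mu, ← Real.rpow_mul (by linarith)]
  ring_nf

theorem tendsto_inv_mu : Tendsto (fun t => (mu t)⁻¹) (𝓝[<] 1) (𝓝 0) := by
  have h : Tendsto (fun t : ℝ => (1 - t) ^ (1 / 2 : ℝ)) (𝓝[<] 1) (𝓝 0) := by
    have h1 : ContinuousAt (fun t : ℝ => (1 - t) ^ (1 / 2 : ℝ)) 1 :=
      ContinuousAt.rpow_const (by fun_prop) (Or.inr (by norm_num))
    have h2 := h1.tendsto.mono_left (nhdsWithin_le_nhds (s := Iio 1))
    simpa using h2
  refine h.congr' ?_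
  filter_upwards [self_mem_nhdsWithin] with t ht
  have : (0 : ℝ) ≤ 1 - t := by linarith [mem_Iio.1 ht]
  rw [mu, Real.rpow_neg this, inv_inv]

theorem hasDerivAt_mu {t : ℝ} (ht : t < 1) : HasDerivAt mu (mu t ^ 3 / 2) t := by
  have h0 : (0 : ℝ) < 1 - t := by linarith
  have h := ((hasDerivAt_id t).const_sub 1).rpow_const (p := (-(1 / 2) : ℝ)) (Or.inl h0.ne')
  refine h.congr_deriv ?_
  rw [mu, ← Real.rpow_natCast, ← Real.rpow_mul h0.le]
  norm_num
  ring

theorem contDiffOn_mu : ContDiffOn ℝ ∞ (fun z : ℝ × E d => mu z.1) (Ico (0 : ℝ) 1 ×ˢ univ) := by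
  unfold mu
  refine ContDiffOn.rpow_const_of_ne (by fun_prop) fun z hz => ?_
  linarith [hz.1.2]

/-- Smooth functions with values in `[0, 1]` and support in the closed unit ball. -/
structure IsProfile (φ : E d → ℝ) : Prop where
  contDiff : ContDiff ℝ ∞ φ
  nonneg : ∀ x, 0 ≤ φ x
  le_one : ∀ x, φ x ≤ 1
  eq_zero : ∀ x, 1 < ‖x‖ → φ x = 0

namespace IsProfile

variable {φ : E d → ℝ}

theorem isTestFun (h : IsProfile φ) : IsTestFun φ :=
  ⟨h.contDiff, HasCompactSupport.intro (isCompact_closedBall (0 : E d) 1) fun x hx =>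
    h.eq_zero x (by simpa using hx)⟩

theorem grad_eq_zero (h : IsProfile φ) {x : E d} (hx : 1 < ‖x‖) : grad φ x = 0 := by
  have h1 : φ =ᶠ[𝓝 x] fun _ => 0 := by
    filter_upwards [(isOpen_lt continuous_const continuous_norm).mem_nhds hx] with y hy
    exact h.eq_zero y hy
  have h2 : fderiv ℝ φ x = 0 := by rw [h1.fderiv_eq]; simp
  ext i
  simp [grad, pderiv, h2]

end IsProfile

/-- The profile `φ` rescaled to the length scale `(mu t)⁻¹`, minus `φ`, times `c`. -/
noncomputable def conc (φ : E d → ℝ) (c t : ℝ) (x : E d) : ℝ :=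
  c * (mu t ^ d * φ (mu t • x) - φ x)

/-- The gradient of `conc φ c t`. -/
noncomputable def gradConc (φ : E d → ℝ) (c t : ℝ) (x : E d) : E d :=
  c • (mu t ^ (d + 1) • grad φ (mu t • x) - grad φ x)

/-- A field whose divergence is `Δ v - ∂ₜ v` for `v = conc φ c`. -/
noncomputable def flux (φ : E d → ℝ) (c t : ℝ) (x : E d) : E d :=
  gradConc φ c t x - (c / 2 * mu t ^ (d + 2) * φ (mu t • x)) • x

section conc

variable {φ : E d → ℝ} {c t : ℝ}

theorem one_lt_norm_mu_smul (ht : t ∈ Ico (0 : ℝ) 1) {x : E d} (hx : 1 < ‖x‖) :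
    1 < ‖mu t • x‖ := by
  rw [norm_smul, Real.norm_of_nonneg (mu_pos ht.2).le]
  exact hx.trans_le (le_mul_of_one_le_left (norm_nonneg _) (one_le_mu ht))

theorem conc_eq_zero (h : IsProfile φ) (ht : t ∈ Ico (0 : ℝ) 1) {x : E d} (hx : 1 < ‖x‖) :
    conc φ c t x = 0 := by
  simp [conc, h.eq_zero x hx, h.eq_zero _ (one_lt_norm_mu_smul ht hx)]

theorem gradConc_eq_zero (h : IsProfile φ) (ht : t ∈ Ico (0 : ℝ) 1) {x : E d} (hx : 1 < ‖x‖) :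
    gradConc φ c t x = 0 := by
  simp [gradConc, h.grad_eq_zero hx, h.grad_eq_zero (one_lt_norm_mu_smul ht hx)]

theorem flux_eq_zero (h : IsProfile φ) (ht : t ∈ Ico (0 : ℝ) 1) {x : E d} (hx : 1 < ‖x‖) :
    flux φ c t x = 0 := by
  simp [flux, gradConc_eq_zero h ht hx, h.eq_zero _ (one_lt_norm_mu_smul ht hx)]

theorem conc_zero : conc φ c 0 = 0 := by ext x; simp [conc, mu_zero]

theorem contDiff_conc (hφ : ContDiff ℝ ∞ φ) : ContDiff ℝ ∞ (conc φ c t) := by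
  unfold conc; fun_prop

theorem smoothOnStrip_conc (hφ : ContDiff ℝ ∞ φ) : SmoothOnStrip (conc φ c) := by
  have h1 : ContDiffOn ℝ ∞ (fun z : ℝ × E d => φ (mu z.1 • z.2)) (Ico (0 : ℝ) 1 ×ˢ univ) :=
    hφ.comp_contDiffOn (contDiffOn_mu.smul contDiffOn_snd)
  exact contDiffOn_const.mul (((contDiffOn_mu.pow d).mul h1).sub
    (hφ.comp_contDiffOn contDiffOn_snd))

theorem smoothOnStrip_gradConc (hφ : ContDiff ℝ ∞ φ) : SmoothOnStrip (gradConc φ c) := by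
  have h1 : ContDiffOn ℝ ∞ (fun z : ℝ × E d => grad φ (mu z.1 • z.2)) (Ico (0 : ℝ) 1 ×ˢ univ) :=
    (contDiff_grad hφ).comp_contDiffOn (contDiffOn_mu.smul contDiffOn_snd)
  have h2 : ContDiffOn ℝ ∞ (fun z : ℝ × E d => grad φ z.2) (Ico (0 : ℝ) 1 ×ˢ univ) :=
    (contDiff_grad hφ).comp_contDiffOn contDiffOn_snd
  exact (((contDiffOn_mu.pow (d + 1)).smul h1).sub h2).const_smul c

theorem smoothOnStrip_flux (hφ : ContDiff ℝ ∞ φ) : SmoothOnStrip (flux φ c) := by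
  have h1 : ContDiffOn ℝ ∞ (fun z : ℝ × E d => φ (mu z.1 • z.2)) (Ico (0 : ℝ) 1 ×ˢ univ) :=
    hφ.comp_contDiffOn (contDiffOn_mu.smul contDiffOn_snd)
  exact (smoothOnStrip_gradConc hφ).sub
    (((contDiffOn_const.mul (contDiffOn_mu.pow (d + 2))).mul h1).smul contDiffOn_snd)

theorem hasFDerivAt_comp_smul (hφ : ContDiff ℝ ∞ φ) (a : ℝ) (x : E d) :
    HasFDerivAt (fun y => φ (a • y)) (a • fderiv ℝ φ (a • x)) x := by
  have h := (hφ.differentiable (by simp) (a • x)).hasFDerivAt.comp x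
    ((hasFDerivAt_id x).const_smul a)
  refine h.congr_fderiv ?_
  ext v
  simp

theorem grad_conc (hφ : ContDiff ℝ ∞ φ) : grad (conc φ c t) = gradConc φ c t := by
  ext x i
  have h := (((hasFDerivAt_comp_smul hφ (mu t) x).const_mul (mu t ^ d)).sub
    (hφ.differentiable (by simp) x).hasFDerivAt).const_mul c
  have h' : fderiv ℝ (conc φ c t) x = _ := h.fderiv
  simp [grad, gradConc, pderiv, h', -mul_eq_mul_left_iff]
  ring

theorem hasDerivAt_conc (hφ : ContDiff ℝ ∞ φ) (ht : t < 1) (x : E d) :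
    HasDerivAt (fun s => conc φ c s x)
      (c / 2 * mu t ^ (d + 2) * (d * φ (mu t • x) + mu t * fderiv ℝ φ (mu t • x) x)) t := by
  have hm := hasDerivAt_mu ht
  have h1 : HasDerivAt (fun s => φ (mu s • x)) (fderiv ℝ φ (mu t • x) ((mu t ^ 3 / 2) • x)) t :=
    (hφ.differentiable (by simp) (mu t • x)).hasFDerivAt.comp_hasDerivAt t (hm.smul_const x)
  have h := (((hm.pow d).mul h1).sub_const (φ x)).const_mul c
  refine h.congr_deriv ?_
  simp only [map_smul, smul_eq_mul, Pi.pow_apply]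
  -- The derivative of `mu ^ d` contains the truncated exponent `d - 1`.
  rcases d with _ | k
  · simp; ring
  · simp; ring

/-- The gradient part contributes the Laplacian. The radial part contributes exactly the time
derivative of `hasDerivAt_conc`, because a mass-preserving dilation is transport along a multiple of
`x`. -/
theorem divergence_flux (hφ : ContDiff ℝ ∞ φ) (x : E d) :
    divergence (flux φ c t) x = Laplacian.laplacian (conc φ c t) x
      - c / 2 * mu t ^ (d + 2) * (d * φ (mu t • x) + mu t * fderiv ℝ φ (mu t • x) x) := by
  have hd := (hasFDerivAt_comp_smul hφ (mu t) x).const_mul (c / 2 * mu t ^ (d + 2))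
  have hg : DifferentiableAt ℝ (gradConc φ c t) x := by
    rw [← grad_conc hφ]
    exact (contDiff_grad (contDiff_conc hφ)).differentiable (by simp) x
  have hs : DifferentiableAt ℝ (fun y => (c / 2 * mu t ^ (d + 2) * φ (mu t • y)) • y) x :=
    hd.differentiableAt.smul differentiableAt_fun_id
  unfold flux
  rw [divergence_sub hg hs,
    divergence_smul_id hd.differentiableAt, hd.fderiv, ← grad_conc hφ,
    divergence_grad (contDiff_conc hφ)]
  simp
  ring

theorem integral_rescale (ht : t < 1) : ∫ x, mu t ^ d * φ (mu t • x) = ∫ x, φ x := by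
  have hm := mu_pos ht
  rw [integral_const_mul, Measure.integral_comp_smul, finrank_euclideanSpace_fin,
    abs_of_pos (by positivity), smul_eq_mul, mul_inv_cancel_left₀ (by positivity)]

theorem lintegral_rescale (h : IsProfile φ) (ht : t < 1) (hc : 0 ≤ c) :
    ∫⁻ x, ENNReal.ofReal (c * (mu t ^ d * φ (mu t • x))) = ENNReal.ofReal (c * ∫ x, φ x) := by
  have hm := mu_pos ht
  have hi : Integrable φ := h.contDiff.continuous.integrable_of_hasCompactSupport h.isTestFun.2
  rw [← ofReal_integral_eq_lintegral_ofReal]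
  · rw [integral_const_mul, integral_rescale ht]
  · exact ((hi.comp_smul hm.ne').const_mul _).const_mul _
  · exact ae_of_all _ fun x => mul_nonneg hc (mul_nonneg (by positivity) (h.nonneg _))

theorem lintegral_conc_le (h : IsProfile φ) (ht : t < 1) (hc : 0 ≤ c) :
    ∫⁻ x, ‖conc φ c t x‖ₑ ≤ ENNReal.ofReal (c * ∫ x, φ x) + ENNReal.ofReal (c * ∫ x, φ x) := by
  have hm := mu_pos ht
  have hi : Integrable φ := h.contDiff.continuous.integrable_of_hasCompactSupport h.isTestFun.2
  have h2 : ∫⁻ x, ENNReal.ofReal (c * φ x) = ENNReal.ofReal (c * ∫ x, φ x) := by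
    rw [← ofReal_integral_eq_lintegral_ofReal (hi.const_mul c)
      (ae_of_all _ fun x => mul_nonneg hc (h.nonneg _)), integral_const_mul]
  have hφc := h.contDiff.continuous
  calc ∫⁻ x, ‖conc φ c t x‖ₑ
      ≤ ∫⁻ x, (ENNReal.ofReal (c * (mu t ^ d * φ (mu t • x))) + ENNReal.ofReal (c * φ x)) := by
        refine lintegral_mono fun x => ?_
        have h3 : 0 ≤ c * (mu t ^ d * φ (mu t • x)) :=
          mul_nonneg hc (mul_nonneg (by positivity) (h.nonneg _))
        have h4 : 0 ≤ c * φ x := mul_nonneg hc (h.nonneg _)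
        rw [← ENNReal.ofReal_add h3 h4, ← ofReal_norm, Real.norm_eq_abs]
        apply ENNReal.ofReal_le_ofReal
        rw [conc, mul_sub, abs_le]
        constructor <;> linarith
    _ = _ := by
        rw [lintegral_add_left (by fun_prop), lintegral_rescale h ht hc, h2]

end conc

/-! ### Local energy bounds. -/

/-- On `[0,T]` the functions `w t` are bounded and integrable, uniformly in `t`. -/
def TameUpTo (T : ℝ) (w : ℝ → E d → ℝ) : Prop :=
  ∃ (M : ℝ) (I : ℝ≥0∞), I ≠ ⊤ ∧ ∀ t ∈ Icc 0 T, (∀ x, |w t x| ≤ M) ∧ ∫⁻ x, ‖w t x‖ₑ ≤ I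

theorem TameUpTo.add {T : ℝ} {v w : ℝ → E d → ℝ} (hv : TameUpTo T v) (hw : TameUpTo T w)
    (hvc : ∀ t ∈ Icc 0 T, Continuous (v t)) :
    TameUpTo T (fun t x => v t x + w t x) := by
  obtain ⟨M, I, hI, h⟩ := hv
  obtain ⟨M', I', hI', h'⟩ := hw
  refine ⟨M + M', I + I', ENNReal.add_ne_top.2 ⟨hI, hI'⟩, fun t ht => ⟨fun x =>
    (abs_add_le _ _).trans (add_le_add ((h t ht).1 x) ((h' t ht).1 x)), ?_⟩⟩
  calc ∫⁻ x, ‖v t x + w t x‖ₑ ≤ ∫⁻ x, (‖v t x‖ₑ + ‖w t x‖ₑ) :=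
        lintegral_mono fun x => enorm_add_le _ _
    _ = (∫⁻ x, ‖v t x‖ₑ) + ∫⁻ x, ‖w t x‖ₑ :=
        lintegral_add_left (by have := hvc t ht; fun_prop) _
    _ ≤ I + I' := add_le_add (h t ht).2 (h' t ht).2

theorem tameUpTo_heat {f : E d → ℝ} (hf : IsTestFun f) (T : ℝ) :
    TameUpTo T (fun t x => heat f (t, x)) := by
  obtain ⟨C, -, hC⟩ := hf.exists_bound
  exact ⟨C, ∫⁻ x, ‖f x‖ₑ, (lintegral_enorm_lt_top hf).ne, fun t _ =>
    ⟨fun x => abs_heat_le hC _, lintegral_enorm_heat_le hf.1.continuous t⟩⟩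

theorem tameUpTo_of_support {w : ℝ → E d → ℝ} {T : ℝ} (hT : T < 1)
    (hw : ContinuousOn (fun z : ℝ × E d => w z.1 z.2) (Ico (0 : ℝ) 1 ×ˢ univ))
    (hs : ∀ t ∈ Ico (0 : ℝ) 1, ∀ x, 1 < ‖x‖ → w t x = 0) : TameUpTo T w := by
  have hI : ∀ t ∈ Icc 0 T, t ∈ Ico (0 : ℝ) 1 := fun t ht => ⟨ht.1, ht.2.trans_lt hT⟩
  obtain ⟨M, hM⟩ := (isCompact_Icc.prod (isCompact_closedBall (0 : E d) 1)).exists_bound_of_continuousOn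
    (hw.mono (prod_mono (fun t ht => hI t ht) (subset_univ _)) :
      ContinuousOn (fun z : ℝ × E d => w z.1 z.2) (Icc 0 T ×ˢ Metric.closedBall 0 1))
  have hb : ∀ t ∈ Icc 0 T, ∀ x, |w t x| ≤ (Metric.closedBall (0 : E d) 1).indicator
      (fun _ => max M 0) x := fun t ht x => by
    by_cases hx : x ∈ Metric.closedBall (0 : E d) 1
    · rw [indicator_of_mem hx]
      exact (hM (t, x) ⟨ht, hx⟩).trans (le_max_left _ _)
    · rw [indicator_of_notMem hx, hs t (hI t ht) x (by simpa using hx), abs_zero]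
  refine ⟨max M 0, ENNReal.ofReal (max M 0) * volume (Metric.closedBall (0 : E d) 1),
    (ENNReal.mul_lt_top ENNReal.ofReal_lt_top measure_closedBall_lt_top).ne, fun t ht =>
    ⟨fun x => (hb t ht x).trans (indicator_le_self' (fun _ _ => le_max_right _ _) x), ?_⟩⟩
  rw [← lintegral_indicator_const measurableSet_closedBall]
  refine lintegral_mono fun x => ?_
  rw [← ofReal_norm, Real.norm_eq_abs]
  refine (ENNReal.ofReal_le_ofReal (hb t ht x)).trans (le_of_eq ?_)
  by_cases hx : x ∈ Metric.closedBall (0 : E d) 1 <;> simp [hx]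

theorem norm_fderiv_le_sum (g : E d → ℝ) (x : E d) :
    ‖fderiv ℝ g x‖ ≤ ∑ i, |pderiv i g x| := by
  refine ContinuousLinearMap.opNorm_le_bound _ (Finset.sum_nonneg fun i _ => abs_nonneg _)
    fun v => ?_
  rw [fderiv_apply_eq_sum, Finset.sum_mul]
  refine (norm_sum_le _ _).trans (Finset.sum_le_sum fun i _ => ?_)
  rw [norm_mul, mul_comm, Real.norm_eq_abs, Real.norm_eq_abs]
  gcongr
  exact abs_coord_le v i

/-- Square integrability is interpolated as `|u|² ≤ (sup |u|) |u|`, and likewise for the gradient.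
-/
theorem memL2locH1_of_tame {u : ℝ → E d → ℝ}
    (hc : ∀ t ∈ Ico (0 : ℝ) 1, ContDiff ℝ ∞ (u t))
    (hu : ∀ T < 1, TameUpTo T u) (hu' : ∀ T < 1, ∀ i, TameUpTo T (fun t => pderiv i (u t))) :
    MemL2locH1 u := by
  intro T _ hT
  obtain ⟨M, I, hI, h⟩ := hu T hT
  choose M' I' hI' h' using hu' T hT
  set K := ENNReal.ofReal M * I + ENNReal.ofReal (∑ i, M' i) * ∑ i, I' i with hK
  have hKt : K < ⊤ := ENNReal.add_lt_top.2
    ⟨ENNReal.mul_lt_top ENNReal.ofReal_lt_top hI.lt_top, ENNReal.mul_lt_top ENNReal.ofReal_lt_top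
      (ENNReal.sum_lt_top.2 fun i _ => (hI' i).lt_top)⟩
  refine lt_of_le_of_lt (setLIntegral_mono (g := fun _ => K) measurable_const fun t ht => ?_) ?_
  · have hct := hc t ⟨ht.1, ht.2.trans_lt hT⟩
    have hcu := hct.continuous
    have hcp := fun i => (contDiff_pderiv hct i).continuous
    calc ∫⁻ x : E d, (‖u t x‖ₑ ^ 2 + ‖fderiv ℝ (u t) x‖ₑ ^ 2)
        ≤ ∫⁻ x : E d, (ENNReal.ofReal M * ‖u t x‖ₑ
            + ENNReal.ofReal (∑ i, M' i) * ∑ i, ‖pderiv i (u t) x‖ₑ) := by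
          refine lintegral_mono fun x => ?_
          have h1 : ‖u t x‖ₑ ≤ ENNReal.ofReal M := by
            rw [← ofReal_norm]; exact ENNReal.ofReal_le_ofReal ((h t ht).1 x)
          have h2 : ‖fderiv ℝ (u t) x‖ₑ ≤ ENNReal.ofReal (∑ i, M' i) := by
            rw [← ofReal_norm]
            exact ENNReal.ofReal_le_ofReal ((norm_fderiv_le_sum _ _).trans
              (Finset.sum_le_sum fun i _ => (h' i t ht).1 x))
          have h3 : ‖fderiv ℝ (u t) x‖ₑ ≤ ∑ i, ‖pderiv i (u t) x‖ₑ := by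
            simp only [← ofReal_norm]
            rw [← ENNReal.ofReal_sum_of_nonneg fun i _ => norm_nonneg _]
            exact ENNReal.ofReal_le_ofReal (norm_fderiv_le_sum _ _)
          rw [sq, sq]
          exact add_le_add (mul_le_mul' h1 le_rfl) (mul_le_mul' h2 h3)
      _ = (ENNReal.ofReal M * ∫⁻ x, ‖u t x‖ₑ)
            + ENNReal.ofReal (∑ i, M' i) * ∑ i, ∫⁻ x, ‖pderiv i (u t) x‖ₑ := by
          rw [lintegral_add_left (by fun_prop), lintegral_const_mul' _ _ ENNReal.ofReal_ne_top,
            lintegral_const_mul' _ _ ENNReal.ofReal_ne_top, lintegral_finsetSum]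
          intro i _
          have := hcp i
          fun_prop
      _ ≤ K := add_le_add (mul_le_mul' le_rfl (h t ht).2)
          (mul_le_mul' le_rfl (Finset.sum_le_sum fun i _ => (h' i t ht).2))
  · rw [lintegral_const, Measure.restrict_apply_univ]
    exact ENNReal.mul_lt_top hKt isCompact_Icc.measure_lt_top

/-! ### Choice of the exponents and of the bump. -/

theorem exists_exponents {r q : ℝ≥0∞} (hr : 1 ≤ r) (hq : 1 ≤ q)
    (hrq : 1 < 2 / r + (d : ℝ≥0∞) / q) :
    ∃ n : ℕ, 1 ≤ n ∧ ∃ β : ℝ, 0 ≤ β ∧ 1 + d / ((n : ℝ) + 1) - d * (1 / q.toReal) ≤ 2 * β ∧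
      (r ≠ ⊤ → β * r.toReal < 1) ∧ (r = ⊤ → β = 0) := by
  have hr0 : r ≠ 0 := (one_pos.trans_le hr).ne'
  have hq0 : q ≠ 0 := (one_pos.trans_le hq).ne'
  have h1 : 2 / r ≠ ⊤ := ENNReal.div_ne_top (by simp) hr0
  have h2 : (d : ℝ≥0∞) / q ≠ ⊤ := ENNReal.div_ne_top (by simp) hq0
  have h3 : 1 < 2 / r.toReal + d * (1 / q.toReal) := by
    have := (ENNReal.toReal_lt_toReal ENNReal.one_ne_top (ENNReal.add_ne_top.2 ⟨h1, h2⟩)).2 hrq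
    rw [ENNReal.toReal_add h1 h2, ENNReal.toReal_div, ENNReal.toReal_div] at this
    simpa [div_eq_mul_inv] using this
  set s : ℝ := d * (1 / q.toReal) with hs
  -- The divisor is the gap in the strict hypothesis; the loss `d / (n + 1)` must fit into it. The
  -- exponent finally used is `n + 1`, so that it is at least `1`.
  obtain ⟨n, hn⟩ := exists_nat_gt (d / (2 / r.toReal + s - 1))
  have hg : 0 < 2 / r.toReal + s - 1 := by linarith
  have h4 : d / (((n + 1 : ℕ) : ℝ) + 1) < 2 / r.toReal + s - 1 := by
    rw [div_lt_iff₀ hg] at hn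
    rw [div_lt_iff₀ (by positivity)]
    push_cast
    nlinarith
  refine ⟨n + 1, by omega, max 0 ((1 + d / (((n + 1 : ℕ) : ℝ) + 1) - s) / 2), le_max_left _ _, ?_,
    fun hrt => ?_, fun hrt => ?_⟩
  · have := le_max_right 0 ((1 + d / (((n + 1 : ℕ) : ℝ) + 1) - s) / 2)
    linarith
  · have hr1 : 0 < r.toReal := ENNReal.toReal_pos hr0 hrt
    rw [← lt_div_iff₀ hr1]
    refine max_lt (by positivity) ?_
    have : 2 / r.toReal = 2 * (1 / r.toReal) := by ring
    linarith
  · subst hrt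
    -- With `2 / r.toReal = 0`, the choice of `n` makes the second entry of the maximum negative.
    simp only [ENNReal.toReal_top, div_zero] at h4
    exact max_eq_left (by linarith)

theorem grad_pow {ρ : E d → ℝ} (hρ : ContDiff ℝ ∞ ρ) (n : ℕ) (x : E d) :
    grad (fun y => ρ y ^ (n + 1)) x = (((n : ℝ) + 1) * ρ x ^ n) • grad ρ x := by
  ext i
  have h := ((hρ.differentiable (by simp) x).hasFDerivAt.pow (n + 1))
  have h' : fderiv ℝ (fun y => ρ y ^ (n + 1)) x = _ := h.fderiv
  simp [grad, pderiv, h']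

/-- A power of a bump function: its gradient is controlled by a smaller power. -/
theorem exists_profile (d n : ℕ) : ∃ (φ ρ : E d → ℝ) (K : ℝ), IsProfile φ ∧ IsProfile ρ ∧
    (∀ x, φ x = ρ x ^ (n + 1)) ∧ 0 ≤ K ∧ (∀ x, ‖grad φ x‖ ≤ K * ρ x ^ n) ∧ 0 < ∫ x, φ x := by
  let ρ : ContDiffBump (0 : E d) := ⟨1 / 2, 1, by norm_num, by norm_num⟩
  have hρ : IsProfile (ρ : E d → ℝ) := ⟨ρ.contDiff, fun x => ρ.nonneg, fun x => ρ.le_one,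
    fun x hx => ρ.zero_of_le_dist (by simpa using hx.le)⟩
  have hφ : IsProfile (fun x => ρ x ^ (n + 1)) := ⟨hρ.contDiff.pow _,
    fun x => pow_nonneg (hρ.nonneg x) _, fun x => pow_le_one₀ (hρ.nonneg x) (hρ.le_one x),
    fun x hx => by simp [hρ.eq_zero x hx]⟩
  obtain ⟨K, hK⟩ := (HasCompactSupport.intro (isCompact_closedBall (0 : E d) 1) fun x hx =>
    hρ.grad_eq_zero (by simpa using hx)).exists_bound_of_continuous
      (contDiff_grad hρ.contDiff).continuous
  have hK0 : 0 ≤ K := (norm_nonneg _).trans (hK 0)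
  refine ⟨_, ρ, (n + 1) * K, hφ, hρ, fun x => rfl, by positivity, fun x => ?_, ?_⟩
  · rw [grad_pow hρ.contDiff, norm_smul, Real.norm_of_nonneg (mul_nonneg (by positivity)
      (pow_nonneg (hρ.nonneg x) _)), mul_right_comm]
    have := hρ.nonneg x
    gcongr
    exact hK x
  · refine hφ.contDiff.continuous.integral_pos_of_hasCompactSupport_nonneg_nonzero
      hφ.isTestFun.2 hφ.nonneg (x := 0) ?_
    have : ρ 0 = 1 := ρ.one_of_mem_closedBall (by simp [ρ])
    simp [this]

/-- With `p = m^(d/(n+1))` and `b = p a` the claim becomes `p b^n ≤ p (1 + b^(n+1))`. This is where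
the high order of vanishing of `φ` pays: the loss is only `p`. -/
theorem pow_mul_pow_le {m a : ℝ} (hm : 0 < m) (ha : 0 ≤ a) (d n : ℕ) :
    m ^ d * a ^ n ≤ m ^ (d / ((n : ℝ) + 1)) * (1 + m ^ d * a ^ (n + 1)) := by
  set p : ℝ := m ^ (d / ((n : ℝ) + 1)) with hp
  have hp0 : 0 < p := Real.rpow_pos_of_pos hm _
  have hpn : p ^ (n + 1) = m ^ d := by
    rw [hp, ← Real.rpow_natCast, ← Real.rpow_mul hm.le, ← Real.rpow_natCast]
    congr 1
    push_cast
    field_simp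
  have h1 : m ^ d * a ^ n = p * (p * a) ^ n := by rw [← hpn]; ring
  have h2 : m ^ d * a ^ (n + 1) = (p * a) ^ (n + 1) := by rw [← hpn]; ring
  rw [h1, h2]
  have hpa : 0 ≤ p * a := by positivity
  gcongr
  rcases le_total (p * a) 1 with h | h
  · exact (pow_le_one₀ hpa h).trans (by linarith [pow_nonneg hpa (n + 1)])
  · exact (pow_le_pow_right₀ h (Nat.le_succ n)).trans (by simp)

/-! ### Pointwise and `L^q` bounds for the drift. -/

section bounds

variable {φ ρ : E d → ℝ} {K c t : ℝ} {n : ℕ}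

theorem norm_flux_le (hφ : IsProfile φ) (hρ : IsProfile ρ) (hφρ : ∀ x, φ x = ρ x ^ (n + 1))
    (hK0 : 0 ≤ K) (hK : ∀ x, ‖grad φ x‖ ≤ K * ρ x ^ n) (hc : 0 ≤ c) (ht : t ∈ Ico (0 : ℝ) 1)
    (x : E d) : ‖flux φ c t x‖ ≤ c * (K + 1) * (mu t ^ (d + 1) * ρ (mu t • x) ^ n + 1) := by
  have hm := mu_pos ht.2
  set y := mu t • x with hy
  have hρn : 0 ≤ ρ y ^ n := pow_nonneg (hρ.nonneg y) n
  have h1 : ‖gradConc φ c t x‖ ≤ c * (mu t ^ (d + 1) * (K * ρ y ^ n) + K) := by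
    rw [gradConc, norm_smul, Real.norm_of_nonneg hc]
    refine mul_le_mul_of_nonneg_left ((norm_sub_le _ _).trans (add_le_add ?_ ?_)) hc
    · rw [norm_smul, Real.norm_of_nonneg (by positivity)]
      exact mul_le_mul_of_nonneg_left (hK _) (by positivity)
    · exact (hK x).trans (mul_le_of_le_one_right hK0 (pow_le_one₀ (hρ.nonneg x) (hρ.le_one x)))
  -- On the support `‖y‖ ≤ 1`, so `mu t * ‖x‖` absorbs one power of `mu t` and the radial term is no
  -- larger than the gradient term.
  have h2 : φ y * ‖y‖ ≤ ρ y ^ n := by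
    rcases le_or_gt ‖y‖ 1 with h | h
    · calc φ y * ‖y‖ ≤ φ y * 1 := mul_le_mul_of_nonneg_left h (hφ.nonneg y)
        _ = ρ y ^ n * ρ y := by rw [hφρ, mul_one, pow_succ]
        _ ≤ ρ y ^ n := mul_le_of_le_one_right hρn (hρ.le_one y)
    · rw [hφ.eq_zero y h, zero_mul]; exact hρn
  have h3 : ‖(c / 2 * mu t ^ (d + 2) * φ y) • x‖ ≤ c * (mu t ^ (d + 1) * ρ y ^ n) := by
    have hny : ‖y‖ = mu t * ‖x‖ := by rw [hy, norm_smul, Real.norm_of_nonneg hm.le]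
    rw [norm_smul, Real.norm_of_nonneg (mul_nonneg (by positivity) (hφ.nonneg y))]
    calc c / 2 * mu t ^ (d + 2) * φ y * ‖x‖ = c / 2 * (mu t ^ (d + 1) * (φ y * ‖y‖)) := by
          rw [hny]; ring
      _ ≤ c * (mu t ^ (d + 1) * ρ y ^ n) := by
          have := mul_nonneg (hφ.nonneg y) (norm_nonneg y)
          gcongr
          linarith
  refine (norm_sub_le _ _).trans ((add_le_add h1 h3).trans ?_)
  nlinarith

theorem norm_inv_smul_flux_le (hφ : IsProfile φ) (hρ : IsProfile ρ)
    (hφρ : ∀ x, φ x = ρ x ^ (n + 1)) (hn : 1 ≤ n) (hK0 : 0 ≤ K)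
    (hK : ∀ x, ‖grad φ x‖ ≤ K * ρ x ^ n) (hc : 0 < c) (ht : t ∈ Ico (0 : ℝ) 1)
    {x : E d} {D : ℝ} (hD : ‖x‖ ≤ 1 → c * (1 + mu t ^ d * φ (mu t • x)) ≤ D) :
    ‖D⁻¹ • flux φ c t x‖ ≤ (Metric.closedBall (0 : E d) (mu t)⁻¹).indicator
        (fun _ => (K + 1) * mu t ^ (1 + d / ((n : ℝ) + 1))) x
      + (Metric.closedBall (0 : E d) 1).indicator (fun _ => K + 1) x := by
  have hm := mu_pos ht.2
  have hP : 0 < mu t ^ (1 + d / ((n : ℝ) + 1)) := Real.rpow_pos_of_pos hm _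
  rcases lt_or_ge 1 ‖x‖ with hx | hx
  · rw [flux_eq_zero hφ ht hx, smul_zero, norm_zero]
    exact add_nonneg (indicator_nonneg (fun _ _ => by positivity) _)
      (indicator_nonneg (fun _ _ => by positivity) _)
  have hD' := hD hx
  set y := mu t • x with hy
  set Q := 1 + mu t ^ d * φ y with hQ
  have hQ1 : 1 ≤ Q := by
    have := mul_nonneg (pow_nonneg hm.le d) (hφ.nonneg y)
    linarith
  have hD0 : 0 < D := (mul_pos hc (by linarith)).trans_le hD'
  rw [indicator_of_mem (show x ∈ Metric.closedBall (0 : E d) 1 by simpa using hx), norm_smul,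
    norm_inv, Real.norm_of_nonneg hD0.le, inv_mul_le_iff₀ hD0]
  have hfl := norm_flux_le hφ hρ hφρ hK0 hK hc.le ht x
  rw [← hy] at hfl
  have hI : mu t ^ (d + 1) * ρ y ^ n ≤ (Metric.closedBall (0 : E d) (mu t)⁻¹).indicator
      (fun _ => mu t ^ (1 + d / ((n : ℝ) + 1))) x * Q := by
    by_cases hxb : x ∈ Metric.closedBall (0 : E d) (mu t)⁻¹
    · rw [indicator_of_mem hxb, Real.rpow_add hm, Real.rpow_one, hQ, hφρ, pow_succ', mul_assoc,
        mul_assoc]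
      exact mul_le_mul_of_nonneg_left (pow_mul_pow_le hm (hρ.nonneg y) d n) hm.le
    -- `1 ≤ n` matters here: `ρ y ^ 0` would not vanish off the small ball.
    · rw [indicator_of_notMem hxb, zero_mul, hρ.eq_zero y ?_, zero_pow (by omega), mul_zero]
      rw [mem_closedBall_zero_iff, not_le, inv_lt_iff_one_lt_mul₀ hm] at hxb
      rw [hy, norm_smul, Real.norm_of_nonneg hm.le, mul_comm]
      exact hxb
  have hind : (Metric.closedBall (0 : E d) (mu t)⁻¹).indicator
      (fun _ => (K + 1) * mu t ^ (1 + d / ((n : ℝ) + 1))) x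
      = (K + 1) * (Metric.closedBall (0 : E d) (mu t)⁻¹).indicator
      (fun _ => mu t ^ (1 + d / ((n : ℝ) + 1))) x := by
    by_cases hxb : x ∈ Metric.closedBall (0 : E d) (mu t)⁻¹ <;> simp [hxb]
  rw [hind]
  set J := (Metric.closedBall (0 : E d) (mu t)⁻¹).indicator
      (fun _ => mu t ^ (1 + d / ((n : ℝ) + 1))) x with hJ
  have hJ0 : 0 ≤ J := indicator_nonneg (fun _ _ => hP.le) _
  calc ‖flux φ c t x‖ ≤ c * (K + 1) * (J * Q + Q) := hfl.trans (by gcongr)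
    _ = c * Q * ((K + 1) * J + (K + 1)) := by ring
    _ ≤ D * ((K + 1) * J + (K + 1)) := by gcongr

theorem volume_closedBall_eq (R : ℝ) (hR : 0 ≤ R) : volume (Metric.closedBall (0 : E d) R)
    = ENNReal.ofReal (R ^ d) * volume (Metric.closedBall (0 : E d) 1) := by
  rw [Measure.addHaar_closedBall' _ _ hR, finrank_euclideanSpace_fin]

theorem eLpNorm_le_of_norm_le {q : ℝ≥0∞} (hq : 1 ≤ q) (ht : t ∈ Ico (0 : ℝ) 1) {F : E d → E d}
    {L a β : ℝ} (hL : 0 ≤ L) (hβ : 0 ≤ β) (hβa : a - d * (1 / q.toReal) ≤ 2 * β)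
    (hF : ∀ x, ‖F x‖ ≤ (Metric.closedBall (0 : E d) (mu t)⁻¹).indicator
        (fun _ => L * mu t ^ a) x + (Metric.closedBall (0 : E d) 1).indicator (fun _ => L) x) :
    eLpNorm F q volume ≤ ENNReal.ofReal (2 * L *
      (volume (Metric.closedBall (0 : E d) 1)).toReal ^ (1 / q.toReal) * (1 - t) ^ (-β)) := by
  have hm := mu_pos ht.2
  set V := (volume (Metric.closedBall (0 : E d) 1)).toReal with hV
  have hVv : volume (Metric.closedBall (0 : E d) 1) = ENNReal.ofReal V :=
    (ENNReal.ofReal_toReal measure_closedBall_lt_top.ne).symm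
  have hV0 : 0 ≤ V := ENNReal.toReal_nonneg
  set e := 1 / q.toReal with he
  have he0 : 0 ≤ e := by positivity
  have hP : 0 < mu t ^ a := Real.rpow_pos_of_pos hm _
  -- The small ball has volume of order `(mu t)^(-d)`, which gains the exponent `d / q`.
  have h1 : eLpNorm ((Metric.closedBall (0 : E d) (mu t)⁻¹).indicator
      (fun _ => L * mu t ^ a)) q volume ≤ ENNReal.ofReal (L * (mu t ^ (a - d * e)) * V ^ e) := by
    refine (eLpNorm_indicator_const_le _ _).trans (le_of_eq ?_)
    rw [← ofReal_norm, Real.norm_of_nonneg (by positivity), volume_closedBall_eq _ (by positivity),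
      hVv, ← ENNReal.ofReal_mul (by positivity), ENNReal.ofReal_rpow_of_nonneg (by positivity) he0,
      ← ENNReal.ofReal_mul (by positivity), Real.mul_rpow (by positivity) hV0, Real.rpow_sub hm,
      inv_pow, Real.inv_rpow (by positivity), Real.rpow_mul hm.le, Real.rpow_natCast]
    congr 1
    ring
  have h2 : eLpNorm ((Metric.closedBall (0 : E d) 1).indicator (fun _ => L)) q volume
      ≤ ENNReal.ofReal (L * V ^ e) := by
    refine (eLpNorm_indicator_const_le _ _).trans (le_of_eq ?_)
    rw [← ofReal_norm, Real.norm_of_nonneg hL, hVv, ENNReal.ofReal_rpow_of_nonneg hV0 he0,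
      ← ENNReal.ofReal_mul hL]
  have hVe : 0 ≤ V ^ e := Real.rpow_nonneg hV0 _
  refine (eLpNorm_mono_real hF).trans ((eLpNorm_add_le
    (measurable_const.indicator measurableSet_closedBall).aestronglyMeasurable
    (measurable_const.indicator measurableSet_closedBall).aestronglyMeasurable hq).trans
    ((add_le_add h1 h2).trans ?_))
  rw [← ENNReal.ofReal_add (mul_nonneg (mul_nonneg hL (Real.rpow_nonneg hm.le _)) hVe)
    (mul_nonneg hL hVe), ← mu_rpow ht.2]
  apply ENNReal.ofReal_le_ofReal
  have h3 : mu t ^ (a - d * e) ≤ mu t ^ (2 * β) := Real.rpow_le_rpow_of_exponent_le (one_le_mu ht) hβa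
  have h4 : 1 ≤ mu t ^ (2 * β) := Real.one_le_rpow (one_le_mu ht) (by positivity)
  have h5 : 0 ≤ L * V ^ e := mul_nonneg hL hVe
  nlinarith [mul_le_mul_of_nonneg_left h3 h5, mul_le_mul_of_nonneg_left h4 h5]

theorem tendsto_volume_closedBall (hd : 1 ≤ d) :
    Tendsto (fun t => volume (Metric.closedBall (0 : E d) (mu t)⁻¹)) (𝓝[<] 1) (𝓝 0) := by
  have h1 : Tendsto (fun t => ENNReal.ofReal ((mu t)⁻¹ ^ d)) (𝓝[<] 1) (𝓝 0) := by
    have := ENNReal.tendsto_ofReal (tendsto_inv_mu.pow d)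
    simpa [zero_pow (show d ≠ 0 by omega)] using this
  have h2 := ENNReal.Tendsto.mul_const (b := volume (Metric.closedBall (0 : E d) 1)) h1
    (Or.inr measure_closedBall_lt_top.ne)
  rw [zero_mul] at h2
  refine h2.congr' ?_
  filter_upwards [self_mem_nhdsWithin] with t ht
  exact (volume_closedBall_eq _ (inv_nonneg.2 (mu_pos ht).le)).symm

end bounds

/-! ### The solution and its drift. -/

/-- The concentrating solution: a heat flow plus a concentrating mean-free perturbation. -/
noncomputable def sol (f φ : E d → ℝ) (c t : ℝ) (x : E d) : ℝ := heat f (t, x) + conc φ c t x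

/-- The velocity field driving `sol`. The cutoff `χ`, which is `1` on the support of the flux, keeps
the denominator positive. -/
noncomputable def drift (f φ χ : E d → ℝ) (c t : ℝ) (x : E d) : E d :=
  (sol f φ c t x + (1 - χ x))⁻¹ • flux φ c t x

/-- The data of the construction and the positivity properties on which it rests. -/
structure Admissible (f φ χ : E d → ℝ) (c : ℝ) : Prop where
  datum : IsTestFun f
  profile : IsProfile φ
  datum_nonneg : ∀ x, 0 ≤ f x
  cutoff_contDiff : ContDiff ℝ ∞ χ
  cutoff_le_one : ∀ x, χ x ≤ 1
  cutoff_eq_one : ∀ x, ‖x‖ ≤ 1 → χ x = 1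
  cutoff_eq_zero : ∀ x, 2 < ‖x‖ → χ x = 0
  pos : 0 < c
  lower : ∀ t ∈ Ico (0 : ℝ) 1, ∀ x : E d, ‖x‖ ≤ 2 → 2 * c ≤ heat f (t, x)

theorem exists_admissible {φ : E d → ℝ} (hφ : IsProfile φ) :
    ∃ (f χ : E d → ℝ) (c : ℝ), Admissible f φ χ c := by
  let f : ContDiffBump (0 : E d) := ⟨4, 5, by norm_num, by norm_num⟩
  let χ : ContDiffBump (0 : E d) := ⟨1, 2, by norm_num, by norm_num⟩
  have hf : IsTestFun (f : E d → ℝ) := ⟨f.contDiff, f.hasCompactSupport⟩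
  -- The lower bound is needed on radius `2`, where the cutoff lives; the plateau radius `4` of `f`
  -- is `R + 2`.
  obtain ⟨m, hm, H⟩ := exists_heat_lower_bound hf (fun x => f.nonneg) (R := 2) (fun x hx =>
    (f.one_of_mem_closedBall (by
      rw [mem_closedBall_zero_iff]; exact hx.trans (by norm_num [f]))).ge)
  refine ⟨f, χ, m / 2, hf, hφ, fun x => f.nonneg, χ.contDiff, fun x => χ.le_one, fun x hx =>
    χ.one_of_mem_closedBall (by simpa using hx), fun x hx =>
    χ.zero_of_le_dist (by simpa using hx.le), half_pos hm, fun t ht x hx => ?_⟩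
  linarith [H t ht x hx]

namespace Admissible

variable {f φ χ : E d → ℝ} {c : ℝ}

/-- Subtracting `c φ ≤ c` uses up at most half of the lower bound `2 * c` for the heat flow. -/
theorem le_sol (h : Admissible f φ χ c) {t : ℝ} (ht : t ∈ Ico (0 : ℝ) 1) {x : E d}
    (hx : ‖x‖ ≤ 2) : c * (1 + mu t ^ d * φ (mu t • x)) ≤ sol f φ c t x := by
  have h1 := h.lower t ht x hx
  have h2 := mul_le_mul_of_nonneg_left (h.profile.le_one x) h.pos.le
  rw [sol, conc]
  linarith

theorem sol_eq_heat (h : Admissible f φ χ c) {t : ℝ} (ht : t ∈ Ico (0 : ℝ) 1) {x : E d}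
    (hx : 1 < ‖x‖) : sol f φ c t x = heat f (t, x) := by
  rw [sol, conc_eq_zero h.profile ht hx, add_zero]

theorem rescale_nonneg (h : Admissible f φ χ c) {t : ℝ} (ht : t ∈ Ico (0 : ℝ) 1) (x : E d) :
    0 ≤ mu t ^ d * φ (mu t • x) :=
  mul_nonneg (pow_nonneg (mu_pos ht.2).le d) (h.profile.nonneg _)

theorem rescale_le_sol (h : Admissible f φ χ c) {t : ℝ} (ht : t ∈ Ico (0 : ℝ) 1) (x : E d) :
    c * (mu t ^ d * φ (mu t • x)) ≤ sol f φ c t x := by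
  rcases le_or_gt ‖x‖ 2 with hx | hx
  · have := h.le_sol ht hx
    have := h.pos
    linarith
  · have hx1 : 1 < ‖x‖ := by linarith
    rw [h.sol_eq_heat ht hx1, h.profile.eq_zero _ (one_lt_norm_mu_smul ht hx1), mul_zero, mul_zero]
    exact heat_nonneg h.datum_nonneg _

/-- Up to radius `2` the solution itself is at least `c`; beyond it the cutoff vanishes and
contributes `1`. No lower bound on the heat flow at infinity is needed. -/
theorem denom_pos (h : Admissible f φ χ c) {t : ℝ} (ht : t ∈ Ico (0 : ℝ) 1) (x : E d) :
    0 < sol f φ c t x + (1 - χ x) := by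
  have hc := h.pos
  rcases le_or_gt ‖x‖ 2 with hx | hx
  · have h1 := h.le_sol ht hx
    have h2 := mul_nonneg hc.le (h.rescale_nonneg ht x)
    linarith [h.cutoff_le_one x]
  · rw [h.cutoff_eq_zero x hx]
    linarith [(mul_nonneg hc.le (h.rescale_nonneg ht x)).trans (h.rescale_le_sol ht x)]

theorem sol_smul_drift (h : Admissible f φ χ c) {t : ℝ} (ht : t ∈ Ico (0 : ℝ) 1) :
    (fun x => sol f φ c t x • drift f φ χ c t x) = flux φ c t := by
  ext1 x
  rw [drift]
  rcases le_or_gt ‖x‖ 1 with hx | hx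
  · have h1 := h.denom_pos ht x
    rw [h.cutoff_eq_one x hx, sub_self, add_zero] at h1 ⊢
    rw [smul_inv_smul₀ h1.ne']
  · rw [flux_eq_zero h.profile ht hx, smul_zero, smul_zero]

theorem drift_eq_zero (h : Admissible f φ χ c) {t : ℝ} (ht : t ∈ Ico (0 : ℝ) 1) {x : E d}
    (hx : 1 < ‖x‖) : drift f φ χ c t x = 0 := by
  rw [drift, flux_eq_zero h.profile ht hx, smul_zero]

theorem smoothOnStrip_sol (h : Admissible f φ χ c) : SmoothOnStrip (sol f φ c) :=
  ((contDiffOn_heat h.datum).mono (prod_mono_left Ico_subset_Ici_self)).add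
    (smoothOnStrip_conc h.profile.contDiff)

theorem smoothOnStrip_drift (h : Admissible f φ χ c) : SmoothOnStrip (drift f φ χ c) := by
  have h1 : ContDiffOn ℝ ∞ (fun z : ℝ × E d => 1 - χ z.2) (Ico (0 : ℝ) 1 ×ˢ univ) :=
    contDiffOn_const.sub (h.cutoff_contDiff.comp_contDiffOn contDiffOn_snd)
  have h2 : ContDiffOn ℝ ∞ (fun z : ℝ × E d => sol f φ c z.1 z.2 + (1 - χ z.2))
      (Ico (0 : ℝ) 1 ×ˢ univ) := ContDiffOn.add h.smoothOnStrip_sol h1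
  exact (h2.inv fun z hz => (h.denom_pos hz.1 z.2).ne').smul
    (smoothOnStrip_flux h.profile.contDiff)

theorem contDiff_sol (h : Admissible f φ χ c) {t : ℝ} (ht : t ∈ Ico (0 : ℝ) 1) :
    ContDiff ℝ ∞ (sol f φ c t) :=
  (contDiff_heat h.datum ht.1).add (contDiff_conc h.profile.contDiff)

theorem isSmoothSolution (h : Admissible f φ χ c) :
    IsSmoothSolution (drift f φ χ c) f (sol f φ c) where
  smooth := h.smoothOnStrip_sol
  initial := by
    ext x
    simp [sol, heat_zero, conc_zero]
  equation t ht x := by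
    have h1 := ((hasDerivWithinAt_heat h.datum t x).mono (Ico_subset_Ici_self : Ico (0 : ℝ) 1 ⊆ Ici 0)).add
      (hasDerivAt_conc (c := c) h.profile.contDiff ht.2 x).hasDerivWithinAt
    have h2 : derivWithin (fun s => sol f φ c s x) (Ico (0 : ℝ) 1) t = _ :=
      h1.derivWithin (uniqueDiffOn_Ico 0 1 t ht)
    have h3 : Laplacian.laplacian (sol f φ c t) x = _ :=
      ((contDiff_heat h.datum ht.1).of_le ENat.LEInfty.out).contDiffAt.laplacian_add
        ((contDiff_conc (c := c) (t := t) h.profile.contDiff).of_le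
          ENat.LEInfty.out).contDiffAt
    rw [h.sol_smul_drift ht, h2, h3, divergence_flux h.profile.contDiff,
      laplacian_heat h.datum ht.1]
    ring

theorem tameUpTo_sol (h : Admissible f φ χ c) {T : ℝ} (hT : T < 1) : TameUpTo T (sol f φ c) :=
  (tameUpTo_heat h.datum T).add (tameUpTo_of_support hT
    (smoothOnStrip_conc h.profile.contDiff).continuousOn
    fun _ ht _ hx => conc_eq_zero h.profile ht hx)
    fun _ ht => (contDiff_heat h.datum ht.1).continuous

theorem tameUpTo_pderiv_sol (h : Admissible f φ χ c) {T : ℝ} (hT : T < 1) (i : Fin d) :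
    TameUpTo T (fun t => pderiv i (sol f φ c t)) := by
  have h1 : TameUpTo T (fun t x => gradConc φ c t x i) := by
    refine tameUpTo_of_support hT ?_ fun t ht x hx => ?_
    · exact (EuclideanSpace.proj (𝕜 := ℝ) i).continuous.comp_continuousOn
        (smoothOnStrip_gradConc (c := c) h.profile.contDiff).continuousOn
    · simp [gradConc_eq_zero h.profile ht hx]
  have h2 := (tameUpTo_heat (h.datum.pderiv i) T).add h1
    fun t ht => (contDiff_heat (h.datum.pderiv i) ht.1).continuous
  obtain ⟨M, I, hI, H⟩ := h2
  refine ⟨M, I, hI, fun t ht => ?_⟩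
  have h3 : pderiv i (sol f φ c t) = fun x => heat (pderiv i f) (t, x) + gradConc φ c t x i := by
    ext x
    have h4 := ((contDiff_heat h.datum ht.1).differentiable (by simp) x).hasFDerivAt.add
      ((contDiff_conc (c := c) (t := t) h.profile.contDiff).differentiable (by simp) x).hasFDerivAt
    have h5 : fderiv ℝ (sol f φ c t) x = _ := h4.fderiv
    rw [pderiv, h5, ← pderiv_heat h.datum, ← grad_conc h.profile.contDiff]
    rfl
  simp only [h3]
  exact H t ht

theorem memL2locH1 (h : Admissible f φ χ c) : MemL2locH1 (sol f φ c) :=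
  memL2locH1_of_tame (fun _ ht => h.contDiff_sol ht) (fun _ hT => h.tameUpTo_sol hT)
    (fun _ hT i => h.tameUpTo_pderiv_sol hT i)

theorem locallyBoundedInTime (h : Admissible f φ χ c) : LocallyBoundedInTime (sol f φ c) := by
  intro T _ hT
  obtain ⟨M, I, -, H⟩ := h.tameUpTo_sol hT
  exact ⟨M, fun t ht => (H t ht).1⟩

theorem uniformlyL1 (h : Admissible f φ χ c) : UniformlyL1 (sol f φ c) := by
  set S := (∫⁻ x, ‖f x‖ₑ) + (ENNReal.ofReal (c * ∫ x, φ x) + ENNReal.ofReal (c * ∫ x, φ x))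
  have hS : S ≠ ⊤ := ENNReal.add_ne_top.2 ⟨(lintegral_enorm_lt_top h.datum).ne,
    ENNReal.add_ne_top.2 ⟨ENNReal.ofReal_ne_top, ENNReal.ofReal_ne_top⟩⟩
  refine ⟨S.toNNReal, fun t ht => ?_⟩
  rw [ENNReal.coe_toNNReal hS, eLpNorm_one_eq_lintegral_enorm]
  have hc := (contDiff_heat h.datum ht.1).continuous
  calc ∫⁻ x, ‖sol f φ c t x‖ₑ ≤ ∫⁻ x, (‖heat f (t, x)‖ₑ + ‖conc φ c t x‖ₑ) :=
        lintegral_mono fun x => enorm_add_le _ _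
    _ = (∫⁻ x, ‖heat f (t, x)‖ₑ) + ∫⁻ x, ‖conc φ c t x‖ₑ :=
        lintegral_add_left hc.enorm.measurable _
    _ ≤ S := add_le_add (lintegral_enorm_heat_le h.datum.1.continuous t)
        (lintegral_conc_le h.profile ht.2 h.pos.le)

theorem concentrates (h : Admissible f φ χ c) (hd : 1 ≤ d) (hφ : 0 < ∫ x, φ x) :
    Concentrates (sol f φ c) (fun t => Metric.closedBall 0 (mu t)⁻¹) (c * ∫ x, φ x) where
  pos := mul_pos h.pos hφ
  measurable t ht := (h.contDiff_sol ht).continuous.measurable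
  measurableSet t := measurableSet_closedBall
  tendsto := tendsto_volume_closedBall hd
  mass t ht := by
    -- The rescaled bump lives in the small ball, lies below the solution, and has constant mass.
    rw [← lintegral_rescale h.profile ht.2 h.pos.le,
      ← setLIntegral_eq_of_support_subset (s := Metric.closedBall 0 (mu t)⁻¹)]
    · refine lintegral_mono fun x => ?_
      rw [← ofReal_norm]
      exact ENNReal.ofReal_le_ofReal ((h.rescale_le_sol ht x).trans (le_abs_self _))
    · intro x hx
      by_contra hxb
      refine hx ?_
      beta_reduce
      have hm := mu_pos ht.2
      rw [mem_closedBall_zero_iff, not_le, inv_lt_iff_one_lt_mul₀ hm] at hxb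
      rw [h.profile.eq_zero (mu t • x) ?_, mul_zero, mul_zero, ENNReal.ofReal_zero]
      rwa [norm_smul, Real.norm_of_nonneg hm.le, mul_comm]

end Admissible

end AdvectionDiffusion

theorem theorem4p1 (d : ℕ) (hd : 1 ≤ d) (r q : ℝ≥0∞) (hr : 1 ≤ r) [hq : Fact (1 ≤ q)]
    (hrq : 1 < 2 / r + (d : ℝ≥0∞) / q) :
    ∃ (b : ℝ → AdvectionDiffusion.E d → AdvectionDiffusion.E d)
      (u₀ : AdvectionDiffusion.E d → ℝ) (u : ℝ → AdvectionDiffusion.E d → ℝ),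
      AdvectionDiffusion.MemLrLq r q b ∧
      AdvectionDiffusion.SmoothOnStrip b ∧
      AdvectionDiffusion.LocallyCompactSupportInTime b ∧
      ContDiff ℝ ∞ u₀ ∧ HasCompactSupport u₀ ∧
      AdvectionDiffusion.IsSmoothSolution b u₀ u ∧
      AdvectionDiffusion.MemL2locH1 u ∧
      AdvectionDiffusion.LocallyBoundedInTime u ∧
      AdvectionDiffusion.UniformlyL1 u ∧
      AdvectionDiffusion.NoBetterThanL1 u ∧
      ¬ AdvectionDiffusion.UniformlyEquiIntegrable u ∧
      ∀ p : ℝ≥0∞, 1 < p →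
        Tendsto (fun t => eLpNorm (u t) p volume) (𝓝[<] (1 : ℝ)) (𝓝 (⊤ : ℝ≥0∞)) := by
  open AdvectionDiffusion in
  obtain ⟨n, hn, β, hβ0, hβ, hβr, hβ'⟩ := exists_exponents hr hq.out hrq
  obtain ⟨φ, ρ, K, hφ, hρ, hφρ, hK0, hK, hpos⟩ := exists_profile d n
  obtain ⟨f, χ, c, h⟩ := exists_admissible hφ
  have hcon := h.concentrates hd hpos
  refine ⟨drift f φ χ c, f, sol f φ c, ?_, h.smoothOnStrip_drift, ?_, h.datum.1, h.datum.2,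
    h.isSmoothSolution, h.memL2locH1, h.locallyBoundedInTime, h.uniformlyL1, hcon.noBetterThanL1,
    hcon.not_uniformlyEquiIntegrable, fun p hp => hcon.tendsto_eLpNorm hp⟩
  · refine memLrLq_of_eLpNorm_le hr h.smoothOnStrip_drift.continuousOn (R := 1)
      (fun t ht x hx => h.drift_eq_zero ht hx) ?_ hβr hβ' fun t ht =>
      eLpNorm_le_of_norm_le hq.out ht (by linarith : 0 ≤ K + 1) hβ0 hβ fun x =>
        norm_inv_smul_flux_le hφ hρ hφρ hn hK0 hK h.pos ht fun hx => ?_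
    · positivity
    -- On the unit ball the denominator is the solution itself, so its lower bound is `le_sol`.
    · rw [h.cutoff_eq_one x hx, sub_self, add_zero]
      exact h.le_sol ht (hx.trans one_le_two)
  · exact fun T _ hT => ⟨Metric.closedBall 0 1, isCompact_closedBall _ _, fun t ht x hx =>
      h.drift_eq_zero ⟨ht.1, ht.2.trans_lt hT⟩ (by simpa using hx)⟩
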